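/- For $x\in\mathbb R$ put $\langle x\rangle=\sqrt{1+x^2}$. Let $p>1$, $a,b\in\mathbb R$, $R\ge 1$, and let $f\in C^2(\mathbb R)$, $g\in C^1(\mathbb R)$ be real-valued with $\operatorname{supp} f,\ \operatorname{supp} g\subset\{x\in\mathbb R:|x|\le R\}$. For $\varepsilon>0$ consider the initial value problem $$u_{tt}-u_{xx}=\frac{|u_t|^p}{\langle t+\langle x\rangle\rangle^{1+a}\,\langle t-\langle x\rangle\rangle^{1+b}},\qquad u(x,0)=\varepsilon f(x),\quad u_t(x,0)=\varepsilon g(x), \qquad (1)$$ and the associated integral equation for $v=u_t$, $$v=\varepsilon u^0_t+L'_{a,b}(|v|^p), \qquad (2)$$ where $u^0_t(x,t)=\frac12\{f'(x+t)-f'(x-t)+g(x+t)+g(x-t)\}$ and $$L'_{a,b}(h)(x,t)=\frac12\int_0^t\frac{h(x+t-s,s)\,ds}{\langle s+\langle x+t-s\rangle\rangle^{1+a}\langle s-\langle x+t-s\rangle\rangle^{1+b}}+\frac12\int_0^t\frac{h(x-t+s,s)\,ds}{\langle s+\langle x-t+s\rangle\rangle^{1+a}\langle s-\langle x-t+s\rangle\rangle^{1+b}}.$$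 For a time interval $I=[0,T]$ with $0<T<\infty$, or $I=[0,\infty)$, say that a solution exists on $I$ if - in the case $p\ge2$, there is a classical solution $u\in C^2(\mathbb R\times I)$ of (1) on $\mathbb R\times I$; - in the case $1<p<2$, there is a function $v\in C(\mathbb R\times I)$ that satisfies (2) on $\mathbb R\times I$ and has $\operatorname{supp} v\subset\{(x,t)\in\mathbb R\times I:|x|\le t+R\}$. Then there are constants $\varepsilon_1>0$ and $c>0$, depending only on $f,g,p,a,b,R$, such that the following holds for every $\varepsilon$ with $0<\varepsilon\le\varepsilon_1$. - If $a>0$ and $p(1+a)+b>0$, a solution exists on $[0,\infty)$. - In each of the remaining cases, a solution exists on $[0,T]$ for every $T>0$ with $$T\le\begin{cases}\exp(c\,\varepsilon^{-(p-1)}) & \text{if } a=0 \text{ and } b\ge -p,\\ \exp(c\,\varepsilon^{-p(p-1)}) & \text{if } a>0 \text{ and } p(1+a)+b=0,\\ c\,\varepsilon^{-(p-1)/(-a)} & \text{if } a<0 \text{ and } b\ge -p,\\ c\,\varepsilon^{-p(p-1)/(-p(1+a)-b)} & \text{if } p(1+a)+b<0 \text{ and } b<-p.\end{cases}$$ -/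

import Mathlib

open Set MeasureTheory

noncomputable section

namespace WeightedWave

/-- The bracket `⟨x⟩ = √(1 + x²)`. -/
def bracket (x : ℝ) : ℝ := Real.sqrt (1 + x ^ 2)

/-- The denominator `⟨t + ⟨x⟩⟩^(1+a) ⟨t - ⟨x⟩⟩^(1+b)`, the product of the characteristic weights. -/
def weight (a b x t : ℝ) : ℝ :=
  bracket (t + bracket x) ^ (1 + a) * bracket (t - bracket x) ^ (1 + b)

/-- `u = u(x,t)` is a classical solution on `ℝ × I` of
`u_tt - u_xx = |u_t|^p / (⟨t+⟨x⟩⟩^(1+a) ⟨t-⟨x⟩⟩^(1+b))`, `u(x,0) = ε f(x)`, `u_t(x,0) = ε g(x)`.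
Here `I` is a time interval `[0,T]` with `T > 0`, or `[0,∞)`; `u` is `C²` on `ℝ × I` up to the
boundary, and time derivatives at the end points of `I` are one-sided. -/
structure IsClassicalSolution (p a b ε : ℝ) (f g : ℝ → ℝ) (I : Set ℝ) (u : ℝ → ℝ → ℝ) :
    Prop where
  contDiffOn : ContDiffOn ℝ 2 (fun z : ℝ × ℝ => u z.1 z.2) (univ ×ˢ I)
  equation : ∀ x : ℝ, ∀ t ∈ I,
    iteratedDerivWithin 2 (fun s => u x s) I t - iteratedDeriv 2 (fun y => u y t) x
      = |derivWithin (fun s => u x s) I t| ^ p / weight a b x t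
  initial_value : ∀ x : ℝ, u x 0 = ε * f x
  initial_velocity : ∀ x : ℝ, derivWithin (fun s => u x s) I 0 = ε * g x

/-- The time derivative `u⁰_t` of the solution of the free wave equation with data `(f,g)`. -/
def freeVelocity (f g : ℝ → ℝ) (x t : ℝ) : ℝ :=
  (1 / 2) * (deriv f (x + t) - deriv f (x - t) + g (x + t) + g (x - t))

/-- The time derivative `L'_{a,b}(v)` of Duhamel's term:
integration over the two backward characteristics through `(x,t)`. -/
def duhamelVelocity (a b : ℝ) (v : ℝ → ℝ → ℝ) (x t : ℝ) : ℝ :=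
  (1 / 2) * (∫ s in (0 : ℝ)..t, v (x + t - s) s / weight a b (x + t - s) s)
    + (1 / 2) * (∫ s in (0 : ℝ)..t, v (x - t + s) s / weight a b (x - t + s) s)

/-- `v` (in the role of `u_t`) is a continuous solution on `ℝ × I` of the integral equation
`v = ε u⁰_t + L'_{a,b}(|v|^p)` with support in `{|x| ≤ t + R}`. This set is closed, so that it
contains the support as soon as `v` vanishes outside it. -/
structure IsIntegralSolution (p a b R ε : ℝ) (f g : ℝ → ℝ) (I : Set ℝ) (v : ℝ → ℝ → ℝ) :
    Prop where
  continuousOn : ContinuousOn (fun z : ℝ × ℝ => v z.1 z.2) (univ ×ˢ I)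
  support : ∀ x : ℝ, ∀ t ∈ I, v x t ≠ 0 → |x| ≤ t + R
  equation : ∀ x : ℝ, ∀ t ∈ I,
    v x t = ε * freeVelocity f g x t + duhamelVelocity a b (fun y s => |v y s| ^ p) x t

/-- A solution exists on `ℝ × I`: a classical one if `p ≥ 2`,
a continuous solution of the integral equation for `u_t` if `p < 2`. -/
def SolutionExists (p a b R ε : ℝ) (f g : ℝ → ℝ) (I : Set ℝ) : Prop :=
  (2 ≤ p → ∃ u : ℝ → ℝ → ℝ, IsClassicalSolution p a b ε f g I u) ∧
  (p < 2 → ∃ v : ℝ → ℝ → ℝ, IsIntegralSolution p a b R ε f g I v)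

end WeightedWave

end

noncomputable section
namespace WeightedWave

open Topology Filter

/-! The right-hand side contains only `u_t`, so the problem closes on `v = u_t`: `v = ε u⁰_t +
L'(|v|^p)`, where `L'` integrates along the two backward characteristics. The equation is solved by
Picard iteration in a supremum norm weighted by an explicit majorant `W` (`envelope`). If `L'` maps
sources bounded by `W^p` to functions bounded by `W / (2p)`, the iteration preserves `|v| ≤ W` and
has Lipschitz constant `1/2`, since `|·|^p` has slope at most `p W^(p-1)` there (`IsContractive`).

The majorant reflects how waves propagate. The free velocity has size `ε` and lives in the strip `|
|x| - t | ≤ R`. A characteristic running along the strip collects `ε^p` times `A₁ = ∫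
(1+s)^(-(1+a))`, so the size `ε` persists there while `ε^(p-1) A₁` is small. A characteristic `t - x
= ξ` that ends inside the cone crosses the opposite strip during a bounded time, where `s + |y|` is
about `ξ`; it collects `ε^p (1+ξ)^(-(1+a))`. Hence the interior solution has size `B (1 + t -
|x|)^(-(1+a))` with `B` of order `ε^p`. Its self-interaction brings in `A₂ = ∫
(1+s)^(-(1+b)-p(1+a))` and stays harmless while `ε^(p(p-1)) A₂` is small.
`IsEnveloped.abs_rayIntegral_le` carries out this computation. If `1 + a < 0` the weight grows; the
growth is frozen at the final time as a factor `Θ` and the decay exponent becomes zero.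

`exists_threshold` turns the two smallness conditions into existence. The integrals `A₁`, `A₂` are
bounded, logarithmic or of power type, according to the signs of `a` and `p(1+a)+b`; this produces
the global case and the lifespans.

For `p ≥ 2` the derivative of `|v|^p` is locally Lipschitz, so the `x`-derivatives of the iterates
converge too (`exists_hasDerivAt_picardLimit`). Then `v` is `C¹` in `x`, and d'Alembert's formula
(`exists_wave_solution`) rebuilds a `C²` function `u`. -/

/-! ### Calculus of integrals along characteristics -/

/-- Differentiation under the integral sign for a jointly continuous integrand. -/
theorem hasDerivAt_integral_param {K K' : ℝ → ℝ → ℝ}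
    (hK : Continuous fun z : ℝ × ℝ => K z.1 z.2) (hK' : Continuous fun z : ℝ × ℝ => K' z.1 z.2)
    (hd : ∀ x s, HasDerivAt (fun y => K y s) (K' x s) x) (x t : ℝ) :
    HasDerivAt (fun y => ∫ s in (0 : ℝ)..t, K y s) (∫ s in (0 : ℝ)..t, K' x s) x := by
  obtain ⟨C, hC⟩ := ((isCompact_closedBall x (1 : ℝ)).prod
    (isCompact_uIcc (a := (0 : ℝ)) (b := t))).exists_bound_of_continuousOn hK'.continuousOn
  refine (intervalIntegral.hasDerivAt_integral_of_dominated_loc_of_deriv_le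
    (bound := fun _ => C) (Metric.closedBall_mem_nhds x one_pos) ?_ ?_ ?_ ?_ ?_ ?_).2
  · exact Filter.Eventually.of_forall fun y =>
      (hK.comp (continuous_const.prodMk continuous_id)).aestronglyMeasurable
  · exact (hK.comp (continuous_const.prodMk continuous_id)).intervalIntegrable _ _
  · exact (hK'.comp (continuous_const.prodMk continuous_id)).aestronglyMeasurable
  · exact Filter.Eventually.of_forall fun s hs y hy => hC (y, s) ⟨hy, uIoc_subset_uIcc hs⟩
  · exact intervalIntegrable_const
  · exact Filter.Eventually.of_forall fun s _ y _ => hd y s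

/-- A function of two real variables with continuous partial derivatives is differentiable. -/
theorem hasFDerivAt_of_partial {f f₁ f₂ : ℝ → ℝ → ℝ}
    (h₁ : Continuous fun z : ℝ × ℝ => f₁ z.1 z.2) (h₂ : Continuous fun z : ℝ × ℝ => f₂ z.1 z.2)
    (hd₁ : ∀ x t, HasDerivAt (fun y => f y t) (f₁ x t) x)
    (hd₂ : ∀ x t, HasDerivAt (fun s => f x s) (f₂ x t) t) (z : ℝ × ℝ) :
    HasFDerivAt (fun z : ℝ × ℝ => f z.1 z.2)
      (f₁ z.1 z.2 • ContinuousLinearMap.fst ℝ ℝ ℝ + f₂ z.1 z.2 • ContinuousLinearMap.snd ℝ ℝ ℝ)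
      z := by
  have := (hasStrictFDerivAt_uncurry_coprod (𝕜 := ℝ) (u := z) (f := f)
    (f₁ := fun x t => (f₁ x t) • (1 : ℝ →L[ℝ] ℝ)) (f₂ := fun x t => (f₂ x t) • (1 : ℝ →L[ℝ] ℝ))
    (Filter.Eventually.of_forall fun v => ?_) (Filter.Eventually.of_forall fun v => ?_)
    (Continuous.continuousAt (h₁.smul continuous_const))
    (Continuous.continuousAt (h₂.smul continuous_const))).hasFDerivAt
  · refine this.congr_fderiv ?_
    ext <;> simp [Function.HasUncurry.uncurry]
  · refine (hd₁ v.1 v.2).hasFDerivAt.congr_fderiv ?_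
    ext; simp [Function.HasUncurry.uncurry]
  · refine (hd₂ v.1 v.2).hasFDerivAt.congr_fderiv ?_
    ext; simp [Function.HasUncurry.uncurry]

theorem contDiff_succ_of_partial {n : ℕ} {f f₁ f₂ : ℝ → ℝ → ℝ}
    (h₁ : ContDiff ℝ n fun z : ℝ × ℝ => f₁ z.1 z.2) (h₂ : ContDiff ℝ n fun z : ℝ × ℝ => f₂ z.1 z.2)
    (hd₁ : ∀ x t, HasDerivAt (fun y => f y t) (f₁ x t) x)
    (hd₂ : ∀ x t, HasDerivAt (fun s => f x s) (f₂ x t) t) :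
    ContDiff ℝ (n + 1) fun z : ℝ × ℝ => f z.1 z.2 := by
  rw [contDiff_succ_iff_hasFDerivAt]
  exact ⟨_, (h₁.smul contDiff_const).add (h₂.smul contDiff_const),
    hasFDerivAt_of_partial h₁.continuous h₂.continuous hd₁ hd₂⟩

/-- The integral of `k` over the backward characteristic of slope `σ` through `(x,t)`. -/
def rayIntegral (σ : ℝ) (k : ℝ → ℝ → ℝ) (x t : ℝ) : ℝ :=
  ∫ s in (0 : ℝ)..t, k (x + σ * (t - s)) s

theorem continuous_rayIntegral (σ : ℝ) {k : ℝ → ℝ → ℝ}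
    (hk : Continuous fun z : ℝ × ℝ => k z.1 z.2) :
    Continuous fun z : ℝ × ℝ => rayIntegral σ k z.1 z.2 := by
  refine intervalIntegral.continuous_parametric_intervalIntegral_of_continuous
    (f := fun (z : ℝ × ℝ) s => k (z.1 + σ * (z.2 - s)) s) ?_ continuous_snd
  have : Continuous fun w : (ℝ × ℝ) × ℝ => (w.1.1 + σ * (w.1.2 - w.2), w.2) := by fun_prop
  exact hk.comp this

theorem hasDerivAt_rayIntegral_fst (σ : ℝ) {k k' : ℝ → ℝ → ℝ}
    (hk : Continuous fun z : ℝ × ℝ => k z.1 z.2) (hk' : Continuous fun z : ℝ × ℝ => k' z.1 z.2)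
    (hd : ∀ x s, HasDerivAt (fun y => k y s) (k' x s) x) (x t : ℝ) :
    HasDerivAt (fun y => rayIntegral σ k y t) (rayIntegral σ k' x t) x := by
  have hc : Continuous fun z : ℝ × ℝ => (z.1 + σ * (t - z.2), z.2) := by fun_prop
  refine hasDerivAt_integral_param (K := fun y s => k (y + σ * (t - s)) s)
    (K' := fun y s => k' (y + σ * (t - s)) s) (hk.comp hc) (hk'.comp hc) (fun y s => ?_) x t
  exact (hd (y + σ * (t - s)) s).comp_add_const y (σ * (t - s))

/-- The time enters both the endpoint and the integrand. Writing the ray through its label `ξ = x +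
σ t` separates the two: `B ξ r` has `ξ` only in the integrand and `r` only in the endpoint, and the
chain rule is applied along `s ↦ (x + σ s, s)`. -/
theorem hasDerivAt_rayIntegral_snd (σ : ℝ) {k k' : ℝ → ℝ → ℝ}
    (hk : Continuous fun z : ℝ × ℝ => k z.1 z.2) (hk' : Continuous fun z : ℝ × ℝ => k' z.1 z.2)
    (hd : ∀ x s, HasDerivAt (fun y => k y s) (k' x s) x) (x t : ℝ) :
    HasDerivAt (fun s => rayIntegral σ k x s) (k x t + σ * rayIntegral σ k' x t) t := by
  have hc : Continuous fun z : ℝ × ℝ => (z.1 - σ * z.2, z.2) := by fun_prop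
  set B : ℝ → ℝ → ℝ := fun ξ r => ∫ s in (0 : ℝ)..r, k (ξ - σ * s) s with hB
  have h₁ : ∀ ξ r, HasDerivAt (fun y => B y r) (∫ s in (0 : ℝ)..r, k' (ξ - σ * s) s) ξ := by
    intro ξ r
    refine hasDerivAt_integral_param (K := fun y s => k (y - σ * s) s)
      (K' := fun y s => k' (y - σ * s) s) (hk.comp hc) (hk'.comp hc) (fun y s => ?_) ξ r
    exact (hd (y - σ * s) s).comp_sub_const y (σ * s)
  have h₂ : ∀ ξ r, HasDerivAt (fun s => B ξ s) (k (ξ - σ * r) r) r := by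
    intro ξ r
    have hcont : Continuous fun s => k (ξ - σ * s) s :=
      (hk.comp hc).comp (continuous_const.prodMk continuous_id : Continuous fun s : ℝ => (ξ, s))
    exact (hcont.integral_hasStrictDerivAt 0 r).hasDerivAt
  have hcont₁ : Continuous fun z : ℝ × ℝ => ∫ s in (0 : ℝ)..z.2, k' (z.1 - σ * s) s := by
    refine intervalIntegral.continuous_parametric_intervalIntegral_of_continuous
      (f := fun (z : ℝ × ℝ) s => k' (z.1 - σ * s) s) ?_ continuous_snd
    have : Continuous fun w : (ℝ × ℝ) × ℝ => (w.1.1 - σ * w.2, w.2) := by fun_prop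
    exact hk'.comp this
  have hF := hasFDerivAt_of_partial (f := B)
    (f₁ := fun ξ r => ∫ s in (0 : ℝ)..r, k' (ξ - σ * s) s) (f₂ := fun ξ r => k (ξ - σ * r) r)
    hcont₁ (hk.comp hc) h₁ h₂ (x + σ * t, t)
  have hp : HasDerivAt (fun s : ℝ => (x + σ * s, s)) (σ, (1 : ℝ)) t := by
    refine HasDerivAt.prodMk ?_ (hasDerivAt_id t)
    simpa using ((hasDerivAt_id t).const_mul σ).const_add x
  have hcomp := HasFDerivAt.comp_hasDerivAt (f := fun s : ℝ => (x + σ * s, s)) t hF hp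
  have e : ∀ (l : ℝ → ℝ → ℝ) (r : ℝ),
      rayIntegral σ l x r = ∫ s in (0 : ℝ)..r, l (x + σ * r - σ * s) s := by
    intro l r
    unfold rayIntegral
    refine intervalIntegral.integral_congr fun s _ => ?_
    congr 1; ring
  have hfun : (fun s => rayIntegral σ k x s) = (fun z : ℝ × ℝ => B z.1 z.2) ∘
      fun s : ℝ => (x + σ * s, s) := by
    funext r; simp [hB, e k r]
  rw [hfun]
  refine hcomp.congr_deriv ?_
  rw [e k' t]
  simp
  ring

/-! ### The bracket and the characteristic weight -/

theorem one_le_bracket (x : ℝ) : 1 ≤ bracket x :=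
  Real.one_le_sqrt.2 (by nlinarith [sq_nonneg x])

theorem bracket_pos (x : ℝ) : 0 < bracket x := one_pos.trans_le (one_le_bracket x)

theorem bracket_neg (x : ℝ) : bracket (-x) = bracket x := by simp [bracket]

theorem abs_le_bracket (x : ℝ) : |x| ≤ bracket x :=
  Real.abs_le_sqrt (by linarith)

theorem bracket_le (x : ℝ) : bracket x ≤ 1 + |x| :=
  Real.sqrt_le_iff.2 ⟨by positivity, by nlinarith [sq_abs x, abs_nonneg x]⟩

theorem hasDerivAt_bracket (x : ℝ) : HasDerivAt bracket (x / bracket x) x := by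
  have h : HasDerivAt (fun y : ℝ => 1 + y ^ 2) (2 * x) x := by
    simpa using (hasDerivAt_pow 2 x).const_add 1
  refine (h.sqrt (by positivity)).congr_deriv ?_
  change 2 * x / (2 * bracket x) = x / bracket x
  rw [mul_div_mul_left _ _ two_ne_zero]

theorem continuous_bracket : Continuous bracket := by unfold bracket; fun_prop

theorem abs_div_bracket_le (x : ℝ) : |x / bracket x| ≤ 1 := by
  rw [abs_div, abs_of_pos (bracket_pos x)]
  exact div_le_one_of_le₀ (abs_le_bracket x) (bracket_pos x).le

theorem abs_div_bracket_sq_le (x : ℝ) : |x / bracket x ^ 2| ≤ 1 := by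
  have h := bracket_pos x
  rw [pow_two, ← div_div, abs_div, abs_of_pos h]
  exact div_le_one_of_le₀ ((abs_div_bracket_le x).trans (one_le_bracket x)) h.le

theorem weight_pos (a b x t : ℝ) : 0 < weight a b x t :=
  mul_pos (Real.rpow_pos_of_pos (bracket_pos _) _) (Real.rpow_pos_of_pos (bracket_pos _) _)

theorem continuous_weight (a b : ℝ) : Continuous fun z : ℝ × ℝ => weight a b z.1 z.2 := by
  unfold weight
  have h₁ : Continuous fun z : ℝ × ℝ => bracket (z.2 + bracket z.1) :=
    continuous_bracket.comp (continuous_snd.add (continuous_bracket.comp continuous_fst))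
  have h₂ : Continuous fun z : ℝ × ℝ => bracket (z.2 - bracket z.1) :=
    continuous_bracket.comp (continuous_snd.sub (continuous_bracket.comp continuous_fst))
  exact (h₁.rpow_const fun z => .inl (bracket_pos _).ne').mul
    (h₂.rpow_const fun z => .inl (bracket_pos _).ne')

/-- The logarithmic derivative in `x` of the weight. -/
def logDerivWeight (a b x t : ℝ) : ℝ :=
  (1 + a) * ((t + bracket x) / bracket (t + bracket x) ^ 2) * (x / bracket x)
    - (1 + b) * ((t - bracket x) / bracket (t - bracket x) ^ 2) * (x / bracket x)

theorem continuous_logDerivWeight (a b : ℝ) :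
    Continuous fun z : ℝ × ℝ => logDerivWeight a b z.1 z.2 := by
  unfold logDerivWeight
  have h₀ : Continuous fun z : ℝ × ℝ => bracket z.1 := continuous_bracket.comp continuous_fst
  have h₁ : Continuous fun z : ℝ × ℝ => bracket (z.2 + bracket z.1) :=
    continuous_bracket.comp (continuous_snd.add h₀)
  have h₂ : Continuous fun z : ℝ × ℝ => bracket (z.2 - bracket z.1) :=
    continuous_bracket.comp (continuous_snd.sub h₀)
  have n (x : ℝ) : bracket x ≠ 0 := (bracket_pos x).ne'
  have n2 (x : ℝ) : bracket x ^ 2 ≠ 0 := pow_ne_zero 2 (n x)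
  refine ((continuous_const.mul ?_).mul ?_).sub ((continuous_const.mul ?_).mul ?_)
  · exact (continuous_snd.add h₀).div (h₁.pow 2) fun z => n2 _
  · exact continuous_fst.div h₀ fun z => n _
  · exact (continuous_snd.sub h₀).div (h₂.pow 2) fun z => n2 _
  · exact continuous_fst.div h₀ fun z => n _

/-- Boundedness of the logarithmic derivative means that differentiating the weight costs a constant
factor only. -/
theorem abs_logDerivWeight_le (a b x t : ℝ) :
    |logDerivWeight a b x t| ≤ |1 + a| + |1 + b| := by
  have h (c y : ℝ) : |c * (y / bracket y ^ 2) * (x / bracket x)| ≤ |c| := by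
    rw [abs_mul, abs_mul]
    exact mul_le_of_le_one_right (by positivity) (abs_div_bracket_le x) |>.trans
      (mul_le_of_le_one_right (by positivity) (abs_div_bracket_sq_le y))
  exact (abs_sub _ _).trans (add_le_add (h _ _) (h _ _))

theorem hasDerivAt_weight (a b x t : ℝ) :
    HasDerivAt (fun y => weight a b y t) (logDerivWeight a b x t * weight a b x t) x := by
  have key (c : ℝ) (φ : ℝ → ℝ) (φ' : ℝ) (h : HasDerivAt φ φ' x) :
      HasDerivAt (fun y => bracket (φ y) ^ c)
        (c * (φ x / bracket (φ x) ^ 2) * φ' * bracket (φ x) ^ c) x := by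
    have hb := bracket_pos (φ x)
    refine (((hasDerivAt_bracket (φ x)).comp x h).rpow_const (.inl hb.ne')).congr_deriv ?_
    rw [Function.comp_apply, Real.rpow_sub_one hb.ne']
    field_simp
  have h₁ := key (1 + a) (fun y => t + bracket y) _ ((hasDerivAt_bracket x).const_add t)
  have h₂ := key (1 + b) (fun y => t - bracket y) _ ((hasDerivAt_bracket x).const_sub t)
  refine (h₁.mul h₂).congr_deriv ?_
  simp only [logDerivWeight, weight]
  ring

/-- Keeping the same denominator makes the `x`-derivative of a Duhamel term again a Duhamel term,
with a modified source, so the estimate assumed for sources applies to it as well. -/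
theorem HasDerivAt.div_weight {a b x t h' : ℝ} {h : ℝ → ℝ} (hd : HasDerivAt h h' x) :
    HasDerivAt (fun y => h y / weight a b y t)
      ((h' - logDerivWeight a b x t * h x) / weight a b x t) x := by
  have hw := (weight_pos a b x t).ne'
  refine (hd.div (hasDerivAt_weight a b x t) hw).congr_deriv ?_
  field_simp

theorem continuous_div_weight (a b : ℝ) {h : ℝ → ℝ → ℝ}
    (hh : Continuous fun z : ℝ × ℝ => h z.1 z.2) :
    Continuous fun z : ℝ × ℝ => h z.1 z.2 / weight a b z.1 z.2 :=
  hh.div (continuous_weight a b) fun _ => (weight_pos _ _ _ _).ne'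

/-! ### The Duhamel term -/

theorem duhamelVelocity_eq (a b : ℝ) (h : ℝ → ℝ → ℝ) (x t : ℝ) :
    duhamelVelocity a b h x t =
      (1 / 2) * rayIntegral 1 (fun y s => h y s / weight a b y s) x t +
      (1 / 2) * rayIntegral (-1) (fun y s => h y s / weight a b y s) x t := by
  have e₁ (s : ℝ) : x + t - s = x + 1 * (t - s) := by ring
  have e₂ (s : ℝ) : x - t + s = x + -1 * (t - s) := by ring
  simp only [duhamelVelocity, rayIntegral, e₁, e₂]

theorem continuous_duhamelVelocity (a b : ℝ) {h : ℝ → ℝ → ℝ}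
    (hh : Continuous fun z : ℝ × ℝ => h z.1 z.2) :
    Continuous fun z : ℝ × ℝ => duhamelVelocity a b h z.1 z.2 := by
  simp only [duhamelVelocity_eq]
  exact (continuous_const.mul (continuous_rayIntegral 1 (continuous_div_weight a b hh))).add
    (continuous_const.mul (continuous_rayIntegral (-1) (continuous_div_weight a b hh)))

theorem continuous_sub_logDerivWeight_mul (a b : ℝ) {h h' : ℝ → ℝ → ℝ}
    (hh : Continuous fun z : ℝ × ℝ => h z.1 z.2) (hh' : Continuous fun z : ℝ × ℝ => h' z.1 z.2) :
    Continuous fun z : ℝ × ℝ => h' z.1 z.2 - logDerivWeight a b z.1 z.2 * h z.1 z.2 :=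
  hh'.sub ((continuous_logDerivWeight a b).mul hh)

theorem hasDerivAt_duhamelVelocity (a b : ℝ) {h h' : ℝ → ℝ → ℝ}
    (hh : Continuous fun z : ℝ × ℝ => h z.1 z.2) (hh' : Continuous fun z : ℝ × ℝ => h' z.1 z.2)
    (hd : ∀ x s, HasDerivAt (fun y => h y s) (h' x s) x) (x t : ℝ) :
    HasDerivAt (fun y => duhamelVelocity a b h y t)
      (duhamelVelocity a b (fun y s => h' y s - logDerivWeight a b y s * h y s) x t) x := by
  simp only [duhamelVelocity_eq]
  have c₁ := continuous_div_weight a b hh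
  have c₂ := continuous_div_weight a b
    (h := fun y s => h' y s - logDerivWeight a b y s * h y s)
    (continuous_sub_logDerivWeight_mul a b hh hh')
  have hd' : ∀ x s, HasDerivAt (fun y => h y s / weight a b y s)
      ((h' x s - logDerivWeight a b x s * h x s) / weight a b x s) x :=
    fun x s => HasDerivAt.div_weight (hd x s)
  exact ((hasDerivAt_rayIntegral_fst 1 c₁ c₂ hd' x t).const_mul _).add
    ((hasDerivAt_rayIntegral_fst (-1) c₁ c₂ hd' x t).const_mul _)

theorem intervalIntegrable_ray (σ : ℝ) {k : ℝ → ℝ → ℝ}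
    (hk : Continuous fun z : ℝ × ℝ => k z.1 z.2) (x t l r : ℝ) :
    IntervalIntegrable (fun s => k (x + σ * (t - s)) s) volume l r := by
  have : Continuous fun s : ℝ => (x + σ * (t - s), s) := by fun_prop
  exact (hk.comp this).intervalIntegrable _ _

theorem rayIntegral_sub (σ : ℝ) {k l : ℝ → ℝ → ℝ} (hk : Continuous fun z : ℝ × ℝ => k z.1 z.2)
    (hl : Continuous fun z : ℝ × ℝ => l z.1 z.2) (x t : ℝ) :
    rayIntegral σ (fun y s => k y s - l y s) x t = rayIntegral σ k x t - rayIntegral σ l x t :=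
  intervalIntegral.integral_sub (intervalIntegrable_ray σ hk x t 0 t)
    (intervalIntegrable_ray σ hl x t 0 t)

theorem duhamelVelocity_sub (a b : ℝ) {h l : ℝ → ℝ → ℝ}
    (hh : Continuous fun z : ℝ × ℝ => h z.1 z.2) (hl : Continuous fun z : ℝ × ℝ => l z.1 z.2)
    (x t : ℝ) :
    duhamelVelocity a b (fun y s => h y s - l y s) x t =
      duhamelVelocity a b h x t - duhamelVelocity a b l x t := by
  simp only [duhamelVelocity_eq, sub_div]
  rw [rayIntegral_sub 1 (continuous_div_weight a b hh) (continuous_div_weight a b hl),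
    rayIntegral_sub (-1) (continuous_div_weight a b hh) (continuous_div_weight a b hl)]
  ring

theorem duhamelVelocity_const_mul (a b c : ℝ) (h : ℝ → ℝ → ℝ) (x t : ℝ) :
    duhamelVelocity a b (fun y s => c * h y s) x t = c * duhamelVelocity a b h x t := by
  simp only [duhamelVelocity, mul_div_assoc, intervalIntegral.integral_const_mul]
  ring

/-! ### The nonlinearity `|v|^p` and its derivative -/

theorem continuous_abs_rpow_comp {X : Type*} [TopologicalSpace X] {p : ℝ} (hp : 0 ≤ p) {h : X → ℝ}
    (hh : Continuous h) : Continuous fun z => |h z| ^ p :=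
  hh.abs.rpow_const fun _ => .inr hp

theorem continuous_comp_snd {k : ℝ → ℝ → ℝ} {τ : ℝ → ℝ}
    (hk : Continuous fun z : ℝ × ℝ => k z.1 z.2) (hτ : Continuous τ) :
    Continuous fun z : ℝ × ℝ => k z.1 (τ z.2) :=
  hk.comp (continuous_fst.prodMk (hτ.comp continuous_snd))

theorem abs_powDeriv {p : ℝ} (hp : 1 < p) (x : ℝ) :
    |p * |x| ^ (p - 2) * x| = p * |x| ^ (p - 1) := by
  have hp0 : 0 < p := by linarith
  rw [abs_mul, abs_mul, abs_of_pos hp0, abs_of_nonneg (Real.rpow_nonneg (abs_nonneg x) _),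
    mul_assoc]
  rcases eq_or_ne x 0 with rfl | hx
  · simp [Real.zero_rpow (sub_ne_zero.2 hp.ne')]
  · have h := Real.rpow_add_one (abs_ne_zero.2 hx) (p - 2)
    rw [← h]
    congr 2
    ring

theorem abs_powDeriv_le {p w x : ℝ} (hp : 1 < p) (hx : |x| ≤ w) :
    |p * |x| ^ (p - 2) * x| ≤ p * w ^ (p - 1) := by
  rw [abs_powDeriv hp]
  have hp0 : 0 < p := by linarith
  exact mul_le_mul_of_nonneg_left (Real.rpow_le_rpow (abs_nonneg x) hx (by linarith)) hp0.le

theorem abs_rpow_sub_abs_rpow_le {p w x y : ℝ} (hp : 1 < p) (hx : |x| ≤ w) (hy : |y| ≤ w) :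
    |(|x| ^ p - |y| ^ p)| ≤ p * w ^ (p - 1) * |x - y| :=
  Convex.norm_image_sub_le_of_norm_hasDerivWithin_le (s := Icc (-w) w)
    (fun _ _ => (hasDerivAt_abs_rpow _ hp).hasDerivWithinAt)
    (fun _ hz => abs_powDeriv_le hp (abs_le.2 hz)) (convex_Icc _ _) (abs_le.1 hy) (abs_le.1 hx)

/-- For `r < 1` the function `|·|^r` is not Lipschitz at the origin, and the factor `|y|` repairs
this: as `|y| ≤ |x|`, the left side is at most `|x|^(r+1) - |y|^(r+1)`, to which the mean value
bound applies. That bound needs an exponent above one, so `r = 0` is split off. -/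
theorem mul_abs_rpow_sub_le {r w x y : ℝ} (hr : 0 ≤ r) (hx : |x| ≤ w) (hyx : |y| ≤ |x|) :
    |y| * |(|x| ^ r - |y| ^ r)| ≤ (r + 1) * w ^ r * |x - y| := by
  have hw : 0 ≤ w := (abs_nonneg x).trans hx
  have hmono : |y| ^ r ≤ |x| ^ r := Real.rpow_le_rpow (abs_nonneg y) hyx hr
  have hmul (z : ℝ) : |z| * |z| ^ r = |z| ^ (r + 1) := by
    rw [mul_comm, Real.rpow_add_one' (abs_nonneg z) (by linarith)]
  rcases hr.eq_or_lt with rfl | hr'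
  · simp
  · rw [abs_of_nonneg (sub_nonneg.2 hmono)]
    have h := (le_abs_self _).trans
      (abs_rpow_sub_abs_rpow_le (p := r + 1) (by linarith) hx (hyx.trans hx))
    rw [add_sub_cancel_right, ← hmul, ← hmul] at h
    nlinarith [Real.rpow_nonneg (abs_nonneg x) r]

theorem abs_powDeriv_sub_le {p w x y : ℝ} (hp : 2 ≤ p) (hx : |x| ≤ w) (hy : |y| ≤ w) :
    |p * |x| ^ (p - 2) * x - p * |y| ^ (p - 2) * y| ≤ p ^ 2 * w ^ (p - 2) * |x - y| := by
  wlog hyx : |y| ≤ |x| generalizing x y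
  · rw [abs_sub_comm, abs_sub_comm x y]
    exact this hy hx (le_of_not_ge hyx)
  have hr : 0 ≤ p - 2 := by linarith
  have h₁ := mul_abs_rpow_sub_le hr hx hyx
  have h₂ : |x| ^ (p - 2) ≤ w ^ (p - 2) := Real.rpow_le_rpow (abs_nonneg x) hx hr
  have e : p * |x| ^ (p - 2) * x - p * |y| ^ (p - 2) * y =
      p * (|x| ^ (p - 2) * (x - y) + y * (|x| ^ (p - 2) - |y| ^ (p - 2))) := by ring
  rw [e, abs_mul, abs_of_nonneg (by linarith : 0 ≤ p)]
  have h₃ : |(|x| ^ (p - 2) * (x - y) + y * (|x| ^ (p - 2) - |y| ^ (p - 2)))| ≤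
      w ^ (p - 2) * |x - y| + (p - 2 + 1) * w ^ (p - 2) * |x - y| := by
    refine (abs_add_le _ _).trans (add_le_add ?_ ?_)
    · rw [abs_mul, abs_of_nonneg (Real.rpow_nonneg (abs_nonneg x) _)]
      exact mul_le_mul_of_nonneg_right h₂ (abs_nonneg _)
    · rwa [abs_mul]
  calc _ ≤ p * (w ^ (p - 2) * |x - y| + (p - 2 + 1) * w ^ (p - 2) * |x - y|) :=
        mul_le_mul_of_nonneg_left h₃ (by linarith)
    _ = _ := by ring

/-! ### Contraction and convergence of the Picard iterates -/

/-- The data of a fixed point problem `v = F + L'_{a,b}(|v|^p)` on `ℝ × I` that is a contraction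
with respect to the weighted supremum norm given by `W`; the map `τ` retracts `ℝ` onto `I`. -/
structure IsContractive (p a b : ℝ) (I : Set ℝ) (τ : ℝ → ℝ) (F W : ℝ → ℝ → ℝ) (M : ℝ) : Prop where
  one_lt : 1 < p
  nonneg : ∀ t ∈ I, 0 ≤ t
  mem_of_le : ∀ t ∈ I, ∀ s, 0 ≤ s → s ≤ t → s ∈ I
  continuous_retract : Continuous τ
  retract_mem : ∀ t, τ t ∈ I
  retract_eq : ∀ t ∈ I, τ t = t
  continuous_source : Continuous fun z : ℝ × ℝ => F z.1 z.2
  bound_nonneg : ∀ x t, 0 ≤ W x t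
  bound_le : ∀ x, ∀ t ∈ I, W x t ≤ M
  source_le : ∀ x, ∀ t ∈ I, |F x t| ≤ W x t / 2
  duhamel_le : ∀ h : ℝ → ℝ → ℝ, (Continuous fun z : ℝ × ℝ => h z.1 z.2) →
    (∀ x, ∀ t ∈ I, |h x t| ≤ W x t ^ p) →
    ∀ x, ∀ t ∈ I, |duhamelVelocity a b h x t| ≤ W x t / (2 * p)

namespace IsContractive

variable {p a b : ℝ} {I : Set ℝ} {τ : ℝ → ℝ} {F W : ℝ → ℝ → ℝ} {M : ℝ}

theorem duhamel_le_mul (H : IsContractive p a b I τ F W M) {h : ℝ → ℝ → ℝ} {C : ℝ} (hC : 0 < C)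
    (hh : Continuous fun z : ℝ × ℝ => h z.1 z.2) (hle : ∀ x, ∀ t ∈ I, |h x t| ≤ C * W x t ^ p)
    (x : ℝ) {t : ℝ} (ht : t ∈ I) : |duhamelVelocity a b h x t| ≤ C * W x t / (2 * p) := by
  have h₁ := H.duhamel_le (fun y s => C⁻¹ * h y s) (continuous_const.mul hh) (fun y s hs => by
    rw [abs_mul, abs_of_pos (inv_pos.2 hC), inv_mul_le_iff₀ hC]
    exact hle y s hs) x t ht
  rw [duhamelVelocity_const_mul, abs_mul, abs_of_pos (inv_pos.2 hC), inv_mul_le_iff₀ hC] at h₁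
  rwa [mul_div_assoc]

theorem rpow_sub_one_mul (H : IsContractive p a b I τ F W M) (x t : ℝ) :
    W x t ^ (p - 1) * W x t = W x t ^ p := by
  have := Real.rpow_add_one' (H.bound_nonneg x t) (y := p - 1) (by linarith [H.one_lt])
  rw [← this, sub_add_cancel]

end IsContractive

/-- The Picard iterates for `v = F + L'_{a,b}(|v|^p)`, extended from `I` to `ℝ` by the
retraction `τ`. -/
def picard (p a b : ℝ) (τ : ℝ → ℝ) (F : ℝ → ℝ → ℝ) : ℕ → ℝ → ℝ → ℝ
  | 0 => fun _ _ => 0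
  | n + 1 => fun x t =>
      F x (τ t) + duhamelVelocity a b (fun y s => |picard p a b τ F n y s| ^ p) x (τ t)

theorem picard_succ (p a b : ℝ) (τ : ℝ → ℝ) (F : ℝ → ℝ → ℝ) (n : ℕ) (x t : ℝ) :
    picard p a b τ F (n + 1) x t =
      F x (τ t) + duhamelVelocity a b (fun y s => |picard p a b τ F n y s| ^ p) x (τ t) := rfl

/-- The derivatives in `x` of the Picard iterates. -/
def picardDeriv (p a b : ℝ) (τ : ℝ → ℝ) (F F' : ℝ → ℝ → ℝ) : ℕ → ℝ → ℝ → ℝ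
  | 0 => fun _ _ => 0
  | n + 1 => fun x t => F' x (τ t) + duhamelVelocity a b (fun y s =>
      p * |picard p a b τ F n y s| ^ (p - 2) * picard p a b τ F n y s *
        picardDeriv p a b τ F F' n y s
      - logDerivWeight a b y s * |picard p a b τ F n y s| ^ p) x (τ t)

/-- The limit of the Picard iterates. -/
def picardLimit (p a b : ℝ) (τ : ℝ → ℝ) (F : ℝ → ℝ → ℝ) (x t : ℝ) : ℝ :=
  ∑' n, (picard p a b τ F (n + 1) x t - picard p a b τ F n x t)

namespace IsContractive

variable {p a b : ℝ} {I : Set ℝ} {τ : ℝ → ℝ} {F W : ℝ → ℝ → ℝ} {M : ℝ}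

theorem continuous_picard (H : IsContractive p a b I τ F W M) (n : ℕ) :
    Continuous fun z : ℝ × ℝ => picard p a b τ F n z.1 z.2 := by
  induction n with
  | zero => exact continuous_const
  | succ n ih =>
    have c₂ : Continuous fun z : ℝ × ℝ => |picard p a b τ F n z.1 z.2| ^ p :=
      continuous_abs_rpow_comp (by linarith [H.one_lt]) ih
    have c₃ := continuous_duhamelVelocity a b (h := fun y s => |picard p a b τ F n y s| ^ p) c₂
    simp only [picard_succ]
    exact (continuous_comp_snd H.continuous_source H.continuous_retract).add
      (continuous_comp_snd c₃ H.continuous_retract)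

theorem abs_picard_le (H : IsContractive p a b I τ F W M) (n : ℕ) (x t : ℝ) :
    |picard p a b τ F n x t| ≤ W x (τ t) := by
  have hp := H.one_lt
  induction n generalizing x t with
  | zero => simpa [picard] using H.bound_nonneg x (τ t)
  | succ n ih =>
    have hτ := H.retract_mem t
    have h₁ := H.duhamel_le (fun y s => |picard p a b τ F n y s| ^ p)
      (continuous_abs_rpow_comp (by linarith) (H.continuous_picard n)) (fun y s hs => by
        rw [abs_of_nonneg (Real.rpow_nonneg (abs_nonneg _) _)]
        refine Real.rpow_le_rpow (abs_nonneg _) ?_ (by linarith)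
        simpa [H.retract_eq s hs] using ih y s) x (τ t) hτ
    have h₂ := H.source_le x (τ t) hτ
    have h₃ : W x (τ t) / (2 * p) ≤ W x (τ t) / 2 :=
      div_le_div_of_nonneg_left (H.bound_nonneg _ _) two_pos (by linarith)
    refine (abs_add_le _ _).trans ?_
    linarith

theorem abs_rpow_sub_le (H : IsContractive p a b I τ F W M) {v w : ℝ → ℝ → ℝ} {C x t : ℝ}
    (hv : |v x t| ≤ W x t) (hw : |w x t| ≤ W x t) (hvw : |v x t - w x t| ≤ C * W x t) :
    |(|v x t| ^ p - |w x t| ^ p)| ≤ p * C * W x t ^ p := by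
  have hp := H.one_lt
  refine (abs_rpow_sub_abs_rpow_le hp hv hw).trans ?_
  rw [← H.rpow_sub_one_mul]
  have : 0 ≤ p * W x t ^ (p - 1) :=
    mul_nonneg (by linarith) (Real.rpow_nonneg (H.bound_nonneg _ _) _)
  nlinarith

/-- The slope `p W^(p-1)` of the nonlinearity cancels against the factor `1/(2p)` in `duhamel_le`;
this leaves the contraction constant `1/2`. -/
theorem abs_duhamel_rpow_sub_le (H : IsContractive p a b I τ F W M) {v w : ℝ → ℝ → ℝ} {C : ℝ}
    (hC : 0 < C) (hvc : Continuous fun z : ℝ × ℝ => v z.1 z.2)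
    (hwc : Continuous fun z : ℝ × ℝ => w z.1 z.2)
    (hv : ∀ x, ∀ t ∈ I, |v x t| ≤ W x t) (hw : ∀ x, ∀ t ∈ I, |w x t| ≤ W x t)
    (hvw : ∀ x, ∀ t ∈ I, |v x t - w x t| ≤ C * W x t) (x : ℝ) {t : ℝ} (ht : t ∈ I) :
    |duhamelVelocity a b (fun y s => |v y s| ^ p) x t -
      duhamelVelocity a b (fun y s => |w y s| ^ p) x t| ≤ C / 2 * W x t := by
  have hp := H.one_lt
  have c₁ := continuous_abs_rpow_comp (p := p) (by linarith) hvc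
  have c₂ := continuous_abs_rpow_comp (p := p) (by linarith) hwc
  rw [← duhamelVelocity_sub a b c₁ c₂]
  refine (H.duhamel_le_mul (C := p * C) (by positivity) (c₁.sub c₂) (fun y s hs =>
    H.abs_rpow_sub_le (hv y s hs) (hw y s hs) (hvw y s hs)) x ht).trans_eq ?_
  field_simp

theorem abs_picard_le_of_mem (H : IsContractive p a b I τ F W M) (n : ℕ) (x : ℝ) {t : ℝ}
    (ht : t ∈ I) : |picard p a b τ F n x t| ≤ W x t := by
  simpa [H.retract_eq t ht] using H.abs_picard_le n x t

theorem abs_picard_sub_le (H : IsContractive p a b I τ F W M) (n : ℕ) (x t : ℝ) :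
    |picard p a b τ F (n + 1) x t - picard p a b τ F n x t| ≤ (1 / 2) ^ n * W x (τ t) := by
  induction n generalizing x t with
  | zero => simpa [picard] using H.abs_picard_le 1 x t
  | succ n ih =>
    have h := H.abs_duhamel_rpow_sub_le (C := (1 / 2) ^ n) (by positivity)
      (H.continuous_picard (n + 1)) (H.continuous_picard n)
      (fun y s hs => H.abs_picard_le_of_mem _ y hs) (fun y s hs => H.abs_picard_le_of_mem _ y hs)
      (fun y s hs => by simpa [H.retract_eq s hs] using ih y s) x (H.retract_mem t)
    rw [picard, picard, add_sub_add_left_eq_sub]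
    exact h.trans_eq (by ring)

theorem abs_picard_sub_le_const (H : IsContractive p a b I τ F W M) (n : ℕ) (x t : ℝ) :
    |picard p a b τ F (n + 1) x t - picard p a b τ F n x t| ≤ (1 / 2) ^ n * M :=
  (H.abs_picard_sub_le n x t).trans
    (mul_le_mul_of_nonneg_left (H.bound_le x _ (H.retract_mem t)) (by positivity))

theorem summable_picard_sub (H : IsContractive p a b I τ F W M) (x t : ℝ) :
    Summable fun n => picard p a b τ F (n + 1) x t - picard p a b τ F n x t :=
  Summable.of_norm_bounded (summable_geometric_two.mul_right M)
    fun n => H.abs_picard_sub_le_const n x t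

theorem tendsto_picard (H : IsContractive p a b I τ F W M) (x t : ℝ) :
    Tendsto (fun n => picard p a b τ F n x t) atTop (𝓝 (picardLimit p a b τ F x t)) := by
  have h := (H.summable_picard_sub x t).hasSum.tendsto_sum_nat
  simp only [Finset.sum_range_sub (fun n => picard p a b τ F n x t)] at h
  have e : picard p a b τ F 0 x t = 0 := rfl
  simp only [e, sub_zero] at h
  exact h

theorem continuous_picardLimit (H : IsContractive p a b I τ F W M) :
    Continuous fun z : ℝ × ℝ => picardLimit p a b τ F z.1 z.2 :=
  continuous_tsum (fun n => (H.continuous_picard (n + 1)).sub (H.continuous_picard n))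
    (summable_geometric_two.mul_right M) fun n z => H.abs_picard_sub_le_const n z.1 z.2

theorem abs_picardLimit_le (H : IsContractive p a b I τ F W M) (x : ℝ) {t : ℝ} (ht : t ∈ I) :
    |picardLimit p a b τ F x t| ≤ W x t :=
  le_of_tendsto (H.tendsto_picard x t).abs
    (Eventually.of_forall fun n => H.abs_picard_le_of_mem n x ht)

theorem abs_picard_sub_picardLimit_le (H : IsContractive p a b I τ F W M) (n : ℕ) (x : ℝ) {t : ℝ}
    (ht : t ∈ I) :
    |picard p a b τ F n x t - picardLimit p a b τ F x t| ≤ 2 * (1 / 2) ^ n * W x t := by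
  have h := dist_le_of_le_geometric_of_tendsto (1 / 2) (W x t) (by norm_num)
    (fun n => ?_) (H.tendsto_picard x t) n
  · rw [Real.dist_eq] at h
    exact h.trans_eq (by ring)
  · rw [dist_comm, Real.dist_eq, mul_comm]
    simpa [H.retract_eq t ht] using H.abs_picard_sub_le n x t

theorem picardLimit_eq (H : IsContractive p a b I τ F W M) (x : ℝ) {t : ℝ} (ht : t ∈ I) :
    picardLimit p a b τ F x t =
      F x t + duhamelVelocity a b (fun y s => |picardLimit p a b τ F y s| ^ p) x t := by
  have h₁ : Tendsto (fun n => duhamelVelocity a b (fun y s => |picard p a b τ F n y s| ^ p) x t)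
      atTop (𝓝 (duhamelVelocity a b (fun y s => |picardLimit p a b τ F y s| ^ p) x t)) := by
    rw [tendsto_iff_norm_sub_tendsto_zero]
    refine squeeze_zero (fun _ => norm_nonneg _) (fun n => H.abs_duhamel_rpow_sub_le
      (C := 2 * (1 / 2) ^ n) (by positivity) (H.continuous_picard n) H.continuous_picardLimit
      (fun y s hs => H.abs_picard_le_of_mem _ y hs) (fun y s hs => H.abs_picardLimit_le y hs)
      (fun y s hs => H.abs_picard_sub_picardLimit_le n y hs) x ht) ?_
    have := ((tendsto_pow_atTop_nhds_zero_of_lt_one (r := (1 / 2 : ℝ)) (by norm_num)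
      (by norm_num)).mul_const (W x t))
    simpa using this
  refine tendsto_nhds_unique ((tendsto_add_atTop_iff_nat 1).2 (H.tendsto_picard x t)) ?_
  simpa [picard, H.retract_eq t ht] using h₁.const_add (F x t)

end IsContractive

/-! ### Convergence of the space derivatives for `p ≥ 2` -/

theorem continuous_powDeriv_comp {X : Type*} [TopologicalSpace X] {p : ℝ} (hp : 2 ≤ p) {h : X → ℝ}
    (hh : Continuous h) : Continuous fun z => p * |h z| ^ (p - 2) * h z :=
  (continuous_const.mul (continuous_abs_rpow_comp (by linarith) hh)).mul hh

namespace IsContractive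

variable {p a b : ℝ} {I : Set ℝ} {τ : ℝ → ℝ} {F F' W : ℝ → ℝ → ℝ} {M C : ℝ}

variable (p a b τ F F') in
/-- The source of the equation for `picardDeriv`. -/
def derivSource (n : ℕ) (y s : ℝ) : ℝ :=
  p * |picard p a b τ F n y s| ^ (p - 2) * picard p a b τ F n y s * picardDeriv p a b τ F F' n y s
    - logDerivWeight a b y s * |picard p a b τ F n y s| ^ p

theorem picardDeriv_succ (n : ℕ) (x t : ℝ) : picardDeriv p a b τ F F' (n + 1) x t =
    F' x (τ t) + duhamelVelocity a b (derivSource p a b τ F F' n) x (τ t) := rfl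

theorem continuous_derivSource (H : IsContractive p a b I τ F W M) (hp : 2 ≤ p) {n : ℕ}
    (h : Continuous fun z : ℝ × ℝ => picardDeriv p a b τ F F' n z.1 z.2) :
    Continuous fun z : ℝ × ℝ => derivSource p a b τ F F' n z.1 z.2 := by
  have c := H.continuous_picard n
  exact ((continuous_powDeriv_comp hp c).mul h).sub
    ((continuous_logDerivWeight a b).mul (continuous_abs_rpow_comp (by linarith) c))

theorem continuous_picardDeriv (H : IsContractive p a b I τ F W M) (hp : 2 ≤ p)
    (hF' : Continuous fun z : ℝ × ℝ => F' z.1 z.2) (n : ℕ) :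
    Continuous fun z : ℝ × ℝ => picardDeriv p a b τ F F' n z.1 z.2 := by
  induction n with
  | zero => exact continuous_const
  | succ n ih =>
    have c₂ := continuous_duhamelVelocity a b (H.continuous_derivSource hp ih)
    simp only [picardDeriv_succ]
    exact (continuous_comp_snd hF' H.continuous_retract).add
      (continuous_comp_snd c₂ H.continuous_retract)

theorem hasDerivAt_picard (H : IsContractive p a b I τ F W M) (hp : 2 ≤ p)
    (hF' : Continuous fun z : ℝ × ℝ => F' z.1 z.2)
    (hd : ∀ x t, HasDerivAt (fun y => F y t) (F' x t) x) (n : ℕ) (x t : ℝ) :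
    HasDerivAt (fun y => picard p a b τ F n y t) (picardDeriv p a b τ F F' n x t) x := by
  induction n generalizing x t with
  | zero => exact hasDerivAt_const x 0
  | succ n ih =>
    have c := H.continuous_picard n
    have c' := H.continuous_picardDeriv hp hF' n
    have c₁ : Continuous fun z : ℝ × ℝ => |picard p a b τ F n z.1 z.2| ^ p :=
      continuous_abs_rpow_comp (by linarith) c
    have c₂ : Continuous fun z : ℝ × ℝ => p * |picard p a b τ F n z.1 z.2| ^ (p - 2) *
        picard p a b τ F n z.1 z.2 * picardDeriv p a b τ F F' n z.1 z.2 :=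
      (continuous_powDeriv_comp hp c).mul c'
    refine (hd x (τ t)).add (hasDerivAt_duhamelVelocity a b
      (h := fun y s => |picard p a b τ F n y s| ^ p)
      (h' := fun y s => p * |picard p a b τ F n y s| ^ (p - 2) *
        picard p a b τ F n y s * picardDeriv p a b τ F F' n y s) c₁ c₂ (fun y s => ?_) x (τ t))
    exact (hasDerivAt_abs_rpow (picard p a b τ F n y s) (by linarith)).comp y (ih y s)

theorem abs_powDeriv_mul_le (H : IsContractive p a b I τ F W M) {v d B x t : ℝ}
    (hv : |v| ≤ W x t) (hd : |d| ≤ B * W x t) :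
    |p * |v| ^ (p - 2) * v * d| ≤ p * B * W x t ^ p := by
  have hp := H.one_lt
  rw [abs_mul, ← H.rpow_sub_one_mul]
  calc _ ≤ (p * W x t ^ (p - 1)) * (B * W x t) := by
        refine mul_le_mul (abs_powDeriv_le hp hv) hd (abs_nonneg _) ?_
        exact mul_nonneg (by linarith) (Real.rpow_nonneg (H.bound_nonneg _ _) _)
    _ = _ := by ring

theorem abs_picardDeriv_le (H : IsContractive p a b I τ F W M) (hp : 2 ≤ p)
    (hF' : Continuous fun z : ℝ × ℝ => F' z.1 z.2) (hC : 0 ≤ C)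
    (hle : ∀ x, ∀ t ∈ I, |F' x t| ≤ C * W x t) (n : ℕ) (x t : ℝ) :
    |picardDeriv p a b τ F F' n x t| ≤
      2 * (C + (|1 + a| + |1 + b|) + 1) * W x (τ t) := by
  set κ := |1 + a| + |1 + b| with hκ
  have hκ0 : 0 ≤ κ := by positivity
  -- Chosen so that `C + (B/2 + κ) ≤ B`: the linearized Duhamel term halves `B`, and the source and
  -- the weight derivative add `C` and at most `κ`.
  set B := 2 * (C + κ + 1) with hB
  induction n generalizing x t with
  | zero =>
    have := mul_nonneg (by positivity : 0 ≤ B) (H.bound_nonneg x (τ t))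
    simpa [picardDeriv] using this
  | succ n ih =>
    have hτ := H.retract_mem t
    have h₁ := H.duhamel_le_mul (C := p * B + κ) (by positivity) (H.continuous_derivSource hp
      (H.continuous_picardDeriv hp hF' n)) (fun y s hs => ?_) x hτ
    · rw [picardDeriv_succ]
      have hW := H.bound_nonneg x (τ t)
      have h₂ : (p * B + κ) * W x (τ t) / (2 * p) ≤ (B / 2 + κ) * W x (τ t) := by
        rw [div_le_iff₀ (by linarith)]
        have : 0 ≤ (2 * p - 1) * (κ * W x (τ t)) := mul_nonneg (by linarith) (by positivity)
        nlinarith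
      have h₃ : C * W x (τ t) + (B / 2 + κ) * W x (τ t) ≤ B * W x (τ t) := by
        rw [← add_mul]
        exact mul_le_mul_of_nonneg_right (by linarith) hW
      exact (abs_add_le _ _).trans (by linarith [hle x (τ t) hτ])
    · have hv := H.abs_picard_le_of_mem n y hs
      have hd := ih y s
      rw [H.retract_eq s hs] at hd
      have h₂ := H.abs_powDeriv_mul_le hv hd
      have h₃ : |logDerivWeight a b y s * |picard p a b τ F n y s| ^ p| ≤ κ * W y s ^ p := by
        rw [abs_mul, abs_of_nonneg (Real.rpow_nonneg (abs_nonneg _) _)]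
        exact mul_le_mul (abs_logDerivWeight_le a b y s)
          (Real.rpow_le_rpow (abs_nonneg _) hv (by linarith)) (by positivity) hκ0
      refine (abs_sub _ _).trans ((add_le_add h₂ h₃).trans_eq (by ring))

/-- The difference splits into three parts: the change of the derivative iterate, which contracts,
and the changes of the coefficient `p|v|^(p-2)v` and of the weight term, both governed by the known
rate `2^(-n)` of the iterates themselves. -/
theorem abs_derivSource_sub_le (H : IsContractive p a b I τ F W M) (hp : 2 ≤ p) {B E : ℝ} {n : ℕ}
    {x t : ℝ} (ht : t ∈ I) (hB : |picardDeriv p a b τ F F' n x t| ≤ B * W x t)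
    (hE : |picardDeriv p a b τ F F' (n + 1) x t - picardDeriv p a b τ F F' n x t| ≤ E * W x t) :
    |derivSource p a b τ F F' (n + 1) x t - derivSource p a b τ F F' n x t| ≤
      p * (E + (p * B + (|1 + a| + |1 + b|)) * (1 / 2) ^ n) * W x t ^ p := by
  set κ := |1 + a| + |1 + b| with hκ
  have hW := H.bound_nonneg x t
  set v := picard p a b τ F n x t with hv
  set v₁ := picard p a b τ F (n + 1) x t with hv₁
  set d := picardDeriv p a b τ F F' n x t
  set d₁ := picardDeriv p a b τ F F' (n + 1) x t
  have lv : |v| ≤ W x t := H.abs_picard_le_of_mem n x ht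
  have lv₁ : |v₁| ≤ W x t := H.abs_picard_le_of_mem (n + 1) x ht
  have lvv : |v₁ - v| ≤ (1 / 2) ^ n * W x t := by
    simpa [H.retract_eq t ht] using H.abs_picard_sub_le n x t
  have h₁ := H.abs_powDeriv_mul_le lv₁ hE
  have h₂ : |(p * |v₁| ^ (p - 2) * v₁ - p * |v| ^ (p - 2) * v) * d| ≤
      p * (p * B * (1 / 2) ^ n) * W x t ^ p := by
    rw [abs_mul]
    have e : W x t ^ (p - 2) * W x t * W x t = W x t ^ p := by
      rw [← Real.rpow_add_one' hW (by linarith), ← Real.rpow_add_one' hW (by linarith)]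
      congr 1; ring
    have h₀ : 0 ≤ p ^ 2 * W x t ^ (p - 2) := mul_nonneg (by positivity) (Real.rpow_nonneg hW _)
    calc _ ≤ (p ^ 2 * W x t ^ (p - 2) * |v₁ - v|) * (B * W x t) :=
          mul_le_mul (abs_powDeriv_sub_le hp lv₁ lv) hB (abs_nonneg _) (by positivity)
      _ ≤ (p ^ 2 * W x t ^ (p - 2) * ((1 / 2) ^ n * W x t)) * (B * W x t) :=
          mul_le_mul_of_nonneg_right (mul_le_mul_of_nonneg_left lvv h₀)
            ((abs_nonneg _).trans hB)
      _ = _ := by rw [← e]; ring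
  have h₃ : |logDerivWeight a b x t * (|v₁| ^ p - |v| ^ p)| ≤
      p * (κ * (1 / 2) ^ n) * W x t ^ p := by
    rw [abs_mul]
    have h := H.abs_rpow_sub_le (v := picard p a b τ F (n + 1)) (w := picard p a b τ F n)
      lv₁ lv lvv
    calc _ ≤ κ * (p * (1 / 2) ^ n * W x t ^ p) :=
          mul_le_mul (abs_logDerivWeight_le a b x t) h (abs_nonneg _) (by positivity)
      _ = _ := by ring
  have e : derivSource p a b τ F F' (n + 1) x t - derivSource p a b τ F F' n x t =
      p * |v₁| ^ (p - 2) * v₁ * (d₁ - d)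
      + (p * |v₁| ^ (p - 2) * v₁ - p * |v| ^ (p - 2) * v) * d
      - logDerivWeight a b x t * (|v₁| ^ p - |v| ^ p) := by
    simp only [derivSource]; ring
  rw [e]
  refine (abs_sub _ _).trans ((add_le_add ((abs_add_le _ _).trans (add_le_add h₁ h₂))
    h₃).trans_eq (by ring))

/-- The errors obey a recursion `Eₙ₊₁ ≤ (Eₙ + c 2^(-n)) / 2`, whose inhomogeneity decays at the same
rate `1/2` as the contraction. Any larger ratio absorbs this resonance; here it is `3/4`. -/
theorem exists_abs_picardDeriv_sub_le (H : IsContractive p a b I τ F W M) (hp : 2 ≤ p)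
    (hF' : Continuous fun z : ℝ × ℝ => F' z.1 z.2) (hC : 0 ≤ C)
    (hle : ∀ x, ∀ t ∈ I, |F' x t| ≤ C * W x t) :
    ∃ K : ℝ, ∀ n x t, |picardDeriv p a b τ F F' (n + 1) x t - picardDeriv p a b τ F F' n x t| ≤
      K * (3 / 4) ^ n * W x (τ t) := by
  set κ := |1 + a| + |1 + b| with hκ
  have hκ0 : 0 ≤ κ := by positivity
  set B := 2 * (C + κ + 1) with hB
  have hB0 : 0 < B := by positivity
  have hbd := H.abs_picardDeriv_le hp hF' hC hle
  -- With `K = 2c` the recursion closes exactly: `(K + K/2) / 2 = 3K/4`.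
  refine ⟨2 * (p * B + κ), fun n => ?_⟩
  induction n with
  | zero =>
    intro x t
    have h := hbd 1 x t
    have hW := H.bound_nonneg x (τ t)
    have h₂ : B * W x (τ t) ≤ 2 * (p * B + κ) * W x (τ t) :=
      mul_le_mul_of_nonneg_right (by nlinarith) hW
    have e : picardDeriv p a b τ F F' 0 x t = 0 := rfl
    rw [e, sub_zero, pow_zero, mul_one]
    exact h.trans h₂
  | succ n ih =>
    intro x t
    set E := 2 * (p * B + κ) * (3 / 4) ^ n with hE
    have hE0 : 0 < E := by positivity
    have hτ := H.retract_mem t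
    have c := fun n => H.continuous_derivSource hp (H.continuous_picardDeriv hp hF' n)
    have h₁ := H.duhamel_le_mul (C := p * (E + (p * B + κ) * (1 / 2) ^ n)) (by positivity)
      (h := fun y s => derivSource p a b τ F F' (n + 1) y s - derivSource p a b τ F F' n y s)
      ((c (n + 1)).sub (c n)) (fun y s hs => H.abs_derivSource_sub_le hp hs
        (by simpa [H.retract_eq s hs] using hbd n y s)
        (by simpa [H.retract_eq s hs] using ih y s)) x hτ
    rw [duhamelVelocity_sub a b (c (n + 1)) (c n)] at h₁
    rw [picardDeriv_succ, picardDeriv_succ, add_sub_add_left_eq_sub]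
    refine h₁.trans ?_
    have hpow : ((1 : ℝ) / 2) ^ n ≤ (3 / 4) ^ n :=
      pow_le_pow_left₀ (by norm_num) (by norm_num) n
    have hW := H.bound_nonneg x (τ t)
    have h₂ : E + (p * B + κ) * (1 / 2) ^ n ≤ 2 * (2 * (p * B + κ) * (3 / 4) ^ (n + 1)) := by
      have := mul_le_mul_of_nonneg_left hpow (by positivity : 0 ≤ p * B + κ)
      rw [pow_succ]
      linarith
    rw [div_le_iff₀ (by positivity)]
    calc _ = (E + (p * B + κ) * (1 / 2) ^ n) * (p * W x (τ t)) := by ring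
      _ ≤ (2 * (2 * (p * B + κ) * (3 / 4) ^ (n + 1))) * (p * W x (τ t)) :=
          mul_le_mul_of_nonneg_right h₂ (by positivity)
      _ = _ := by ring

/-- The boundedness of `W` makes the series of derivatives uniformly summable on all of `ℝ × ℝ`,
which permits termwise differentiation. -/
theorem exists_hasDerivAt_picardLimit (H : IsContractive p a b I τ F W M) (hp : 2 ≤ p)
    (hF' : Continuous fun z : ℝ × ℝ => F' z.1 z.2)
    (hd : ∀ x t, HasDerivAt (fun y => F y t) (F' x t) x) (hC : 0 ≤ C)
    (hle : ∀ x, ∀ t ∈ I, |F' x t| ≤ C * W x t) :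
    ∃ v' : ℝ → ℝ → ℝ, (Continuous fun z : ℝ × ℝ => v' z.1 z.2) ∧
      ∀ x t, HasDerivAt (fun y => picardLimit p a b τ F y t) (v' x t) x := by
  obtain ⟨K, hK⟩ := H.exists_abs_picardDeriv_sub_le hp hF' hC hle
  have hbd : ∀ n x t, ‖picardDeriv p a b τ F F' (n + 1) x t - picardDeriv p a b τ F F' n x t‖ ≤
      (3 / 4) ^ n * (|K| * M) := by
    intro n x t
    have hW := H.bound_nonneg x (τ t)
    have hM := H.bound_le x (τ t) (H.retract_mem t)
    calc _ ≤ K * (3 / 4) ^ n * W x (τ t) := hK n x t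
      _ ≤ |K| * (3 / 4) ^ n * M := by
          gcongr
          exact le_abs_self K
      _ = _ := by ring
  have hs : Summable fun n : ℕ => ((3 : ℝ) / 4) ^ n * (|K| * M) :=
    (summable_geometric_of_lt_one (by norm_num) (by norm_num)).mul_right _
  refine ⟨fun x t => ∑' n, (picardDeriv p a b τ F F' (n + 1) x t - picardDeriv p a b τ F F' n x t),
    continuous_tsum (fun n => (H.continuous_picardDeriv hp hF' (n + 1)).sub
      (H.continuous_picardDeriv hp hF' n)) hs fun n z => hbd n z.1 z.2, fun x t => ?_⟩
  exact hasDerivAt_tsum (y₀ := x) hs (fun n y => (H.hasDerivAt_picard hp hF' hd (n + 1) y t).sub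
    (H.hasDerivAt_picard hp hF' hd n y t)) (fun n y => hbd n y t) (H.summable_picard_sub x t) x

end IsContractive

/-! ### The linear wave equation with a given source -/

theorem hasDerivAt_travel_fst {A A' : ℝ → ℝ} (hA : ∀ y, HasDerivAt A (A' y) y) (x t : ℝ) :
    HasDerivAt (fun y => A (y + t)) (A' (x + t)) x ∧
      HasDerivAt (fun y => A (y - t)) (A' (x - t)) x :=
  ⟨(hA _).comp_add_const x t, (hA _).comp_sub_const x t⟩

theorem hasDerivAt_travel_snd {A A' : ℝ → ℝ} (hA : ∀ y, HasDerivAt A (A' y) y) (x t : ℝ) :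
    HasDerivAt (fun s => A (x + s)) (A' (x + t)) t ∧
      HasDerivAt (fun s => A (x - s)) (-A' (x - t)) t :=
  ⟨(hA _).comp_const_add x t, (hA _).comp_const_sub x t⟩

/-- The linear wave equation with a source that is `C¹` in the space variable: the solution
with velocity `v` at `(x,t)`, and its space derivative `w`. -/
theorem exists_wave_solution {φ A B A' B' : ℝ → ℝ} {k k' : ℝ → ℝ → ℝ}
    (hA : ∀ y, HasDerivAt A (A' y) y) (hB : ∀ y, HasDerivAt B (B' y) y)
    (hA' : Continuous A') (hB' : Continuous B')
    (hφ : ∀ y, HasDerivAt φ ((1 / 2) * (A y - B y)) y)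
    (hk : Continuous fun z : ℝ × ℝ => k z.1 z.2) (hk' : Continuous fun z : ℝ × ℝ => k' z.1 z.2)
    (hd : ∀ x s, HasDerivAt (fun y => k y s) (k' x s) x) {v : ℝ → ℝ → ℝ}
    (hv : ∀ x t, v x t = (1 / 2) * (A (x + t) + B (x - t)) +
      ((1 / 2) * rayIntegral 1 k x t + (1 / 2) * rayIntegral (-1) k x t)) :
    ∃ u w v' w' : ℝ → ℝ → ℝ, (ContDiff ℝ 2 fun z : ℝ × ℝ => u z.1 z.2) ∧ (∀ x, u x 0 = φ x) ∧
      (∀ x t, HasDerivAt (fun s => u x s) (v x t) t) ∧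
      (∀ x t, HasDerivAt (fun s => v x s) (v' x t) t) ∧
      (∀ x t, HasDerivAt (fun y => u y t) (w x t) x) ∧
      (∀ x t, HasDerivAt (fun y => w y t) (w' x t) x) ∧
      ∀ x t, v' x t - w' x t = k x t := by
  obtain rfl : v = fun x t => (1 / 2) * (A (x + t) + B (x - t)) +
      ((1 / 2) * rayIntegral 1 k x t + (1 / 2) * rayIntegral (-1) k x t) := by
    funext x t; exact hv x t
  clear hv
  set v : ℝ → ℝ → ℝ := fun x t => (1 / 2) * (A (x + t) + B (x - t)) +
      ((1 / 2) * rayIntegral 1 k x t + (1 / 2) * rayIntegral (-1) k x t) with hv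
  -- `w` is the future `u_x`, and `q` below is the common value of `v_x` and `w_t`. Thus all first
  -- derivatives of `v` and `w` are continuous, although `k` is not differentiated in time.
  set w : ℝ → ℝ → ℝ := fun x t => (1 / 2) * (A (x + t) - B (x - t)) +
      ((1 / 2) * rayIntegral 1 k x t - (1 / 2) * rayIntegral (-1) k x t) with hw
  set q : ℝ → ℝ → ℝ := fun x t => (1 / 2) * (A' (x + t) + B' (x - t)) +
      ((1 / 2) * rayIntegral 1 k' x t + (1 / 2) * rayIntegral (-1) k' x t) with hq
  set w' : ℝ → ℝ → ℝ := fun x t => (1 / 2) * (A' (x + t) - B' (x - t)) +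
      ((1 / 2) * rayIntegral 1 k' x t - (1 / 2) * rayIntegral (-1) k' x t) with hw'
  have hr₁ := continuous_rayIntegral 1 hk'
  have hr₂ := continuous_rayIntegral (-1) hk'
  have cA : Continuous fun z : ℝ × ℝ => A' (z.1 + z.2) := hA'.comp (by fun_prop)
  have cB : Continuous fun z : ℝ × ℝ => B' (z.1 - z.2) := hB'.comp (by fun_prop)
  have cq : Continuous fun z : ℝ × ℝ => q z.1 z.2 :=
    (continuous_const.mul (cA.add cB)).add
      ((continuous_const.mul hr₁).add (continuous_const.mul hr₂))
  have cw' : Continuous fun z : ℝ × ℝ => w' z.1 z.2 :=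
    (continuous_const.mul (cA.sub cB)).add
      ((continuous_const.mul hr₁).sub (continuous_const.mul hr₂))
  have hvx : ∀ x t, HasDerivAt (fun y => v y t) (q x t) x := fun x t =>
    (((hasDerivAt_travel_fst hA x t).1.add (hasDerivAt_travel_fst hB x t).2).const_mul _).add
      (((hasDerivAt_rayIntegral_fst 1 hk hk' hd x t).const_mul _).add
        ((hasDerivAt_rayIntegral_fst (-1) hk hk' hd x t).const_mul _))
  have hwx : ∀ x t, HasDerivAt (fun y => w y t) (w' x t) x := fun x t =>
    (((hasDerivAt_travel_fst hA x t).1.sub (hasDerivAt_travel_fst hB x t).2).const_mul _).add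
      (((hasDerivAt_rayIntegral_fst 1 hk hk' hd x t).const_mul _).sub
        ((hasDerivAt_rayIntegral_fst (-1) hk hk' hd x t).const_mul _))
  have hvt : ∀ x t, HasDerivAt (fun s => v x s) (w' x t + k x t) t := fun x t =>
    ((((hasDerivAt_travel_snd hA x t).1.add (hasDerivAt_travel_snd hB x t).2).const_mul _).add
      (((hasDerivAt_rayIntegral_snd 1 hk hk' hd x t).const_mul _).add
        ((hasDerivAt_rayIntegral_snd (-1) hk hk' hd x t).const_mul _))).congr_deriv
      (by simp only [hw']; ring)
  have hwt : ∀ x t, HasDerivAt (fun s => w x s) (q x t) t := fun x t =>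
    ((((hasDerivAt_travel_snd hA x t).1.sub (hasDerivAt_travel_snd hB x t).2).const_mul _).add
      (((hasDerivAt_rayIntegral_snd 1 hk hk' hd x t).const_mul _).sub
        ((hasDerivAt_rayIntegral_snd (-1) hk hk' hd x t).const_mul _))).congr_deriv
      (by simp only [hq]; ring)
  have cv : ContDiff ℝ ((0 : ℕ) + 1) fun z : ℝ × ℝ => v z.1 z.2 :=
    contDiff_succ_of_partial (f₂ := fun x t => w' x t + k x t) (contDiff_zero.2 cq)
      (contDiff_zero.2 (cw'.add hk)) hvx hvt
  have cw : ContDiff ℝ ((0 : ℕ) + 1) fun z : ℝ × ℝ => w z.1 z.2 :=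
    contDiff_succ_of_partial (contDiff_zero.2 cw') (contDiff_zero.2 cq) hwx hwt
  set u : ℝ → ℝ → ℝ := fun x t => φ x + ∫ s in (0 : ℝ)..t, v x s with hu
  have hut : ∀ x t, HasDerivAt (fun s => u x s) (v x t) t := fun x t => by
    have hc : Continuous fun s => v x s :=
      cv.continuous.comp (continuous_const.prodMk continuous_id : Continuous fun s : ℝ => (x, s))
    exact (hc.integral_hasStrictDerivAt 0 t).hasDerivAt.const_add _
  have hux : ∀ x t, HasDerivAt (fun y => u y t) (w x t) x := fun x t => by
    refine ((hφ x).add (hasDerivAt_integral_param cv.continuous cq hvx x t)).congr_deriv ?_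
    have hc : Continuous fun s => q x s :=
      cq.comp (continuous_const.prodMk continuous_id : Continuous fun s : ℝ => (x, s))
    -- Since `q = w_t`, the integral equals `w x t - w x 0`, and `w x 0 = (A x - B x) / 2` is the
    -- derivative of `φ`.
    rw [intervalIntegral.integral_eq_sub_of_hasDerivAt (fun s _ => hwt x s)
      (hc.intervalIntegrable 0 t)]
    simp [hw, rayIntegral]
  refine ⟨u, w, fun x t => w' x t + k x t, w', ?_, fun x => by simp [hu], hut, hvt, hux, hwx,
    fun x t => by ring⟩
  have : ContDiff ℝ ((1 : ℕ) + 1) fun z : ℝ × ℝ => u z.1 z.2 :=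
    contDiff_succ_of_partial (by simpa using cw) (by simpa using cv) hux hut
  exact this.of_le (by norm_num [one_add_one_eq_two])

theorem derivWithin_eqOn {I : Set ℝ} (hI : UniqueDiffOn ℝ I) {φ φ' : ℝ → ℝ}
    (h : ∀ t, HasDerivAt φ (φ' t) t) : EqOn (derivWithin φ I) φ' I := fun t ht =>
  (h t).hasDerivWithinAt.derivWithin (hI t ht)

/-! ### From the fixed point to solutions of the initial value problem -/

variable {p a b R ε : ℝ} {f g : ℝ → ℝ}

/-- The `x`-derivative of `freeVelocity`. -/
def freeVelocityDeriv (f g : ℝ → ℝ) (x t : ℝ) : ℝ :=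
  (1 / 2) * (deriv (deriv f) (x + t) - deriv (deriv f) (x - t) + deriv g (x + t) + deriv g (x - t))

theorem contDiff_one_deriv (hf : ContDiff ℝ 2 f) : ContDiff ℝ 1 (deriv f) :=
  ((contDiff_succ_iff_deriv (n := 1)).1 (by simpa [one_add_one_eq_two] using hf)).2.2

theorem continuous_freeVelocity (hf : ContDiff ℝ 2 f) (hg : ContDiff ℝ 1 g) :
    Continuous fun z : ℝ × ℝ => freeVelocity f g z.1 z.2 := by
  have h₁ := (contDiff_one_deriv hf).continuous
  have h₂ := hg.continuous
  unfold freeVelocity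
  fun_prop

theorem continuous_freeVelocityDeriv (hf : ContDiff ℝ 2 f) (hg : ContDiff ℝ 1 g) :
    Continuous fun z : ℝ × ℝ => freeVelocityDeriv f g z.1 z.2 := by
  have h₁ := (contDiff_one_deriv hf).continuous_deriv_one
  have h₂ := hg.continuous_deriv_one
  unfold freeVelocityDeriv
  fun_prop

theorem hasDerivAt_freeVelocity (hf : ContDiff ℝ 2 f) (hg : ContDiff ℝ 1 g) (x t : ℝ) :
    HasDerivAt (fun y => freeVelocity f g y t) (freeVelocityDeriv f g x t) x := by
  have h₁ : ∀ y, HasDerivAt (deriv f) (deriv (deriv f) y) y := fun y =>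
    ((contDiff_one_deriv hf).differentiable one_ne_zero y).hasDerivAt
  have h₂ : ∀ y, HasDerivAt g (deriv g y) y := fun y =>
    (hg.differentiable one_ne_zero y).hasDerivAt
  exact ((((hasDerivAt_travel_fst h₁ x t).1.sub (hasDerivAt_travel_fst h₁ x t).2).add
    (hasDerivAt_travel_fst h₂ x t).1).add (hasDerivAt_travel_fst h₂ x t).2).const_mul _

namespace IsContractive

variable {I : Set ℝ} {τ : ℝ → ℝ} {F W : ℝ → ℝ → ℝ} {M C : ℝ}

theorem exists_isIntegralSolution
    (H : IsContractive p a b I τ (fun x t => ε * freeVelocity f g x t) W M)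
    (hW : ∀ x, ∀ t ∈ I, W x t ≠ 0 → |x| ≤ t + R) :
    ∃ v, IsIntegralSolution p a b R ε f g I v :=
  ⟨picardLimit p a b τ fun x t => ε * freeVelocity f g x t,
    { continuousOn := H.continuous_picardLimit.continuousOn
      support := fun x t ht h => hW x t ht fun h0 => h <| by
        have := H.abs_picardLimit_le x ht
        rwa [h0, abs_nonpos_iff] at this
      equation := fun x _ ht => H.picardLimit_eq x ht }⟩

theorem exists_isClassicalSolution (hf : ContDiff ℝ 2 f) (hg : ContDiff ℝ 1 g)
    (hI : UniqueDiffOn ℝ I) (hp : 2 ≤ p)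
    (H : IsContractive p a b I τ (fun x t => ε * freeVelocity f g x t) W M) (hC : 0 ≤ C)
    (hle : ∀ x, ∀ t ∈ I, |ε * freeVelocityDeriv f g x t| ≤ C * W x t) :
    ∃ u, IsClassicalSolution p a b ε f g I u := by
  have h0 : (0 : ℝ) ∈ I := H.mem_of_le _ (H.retract_mem 0) 0 le_rfl (H.nonneg _ (H.retract_mem 0))
  set m := picardLimit p a b τ fun x t => ε * freeVelocity f g x t with hm
  have cm : Continuous fun z : ℝ × ℝ => m z.1 z.2 := H.continuous_picardLimit
  obtain ⟨m', cm', hm'⟩ := H.exists_hasDerivAt_picardLimit hp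
    (F' := fun x t => ε * freeVelocityDeriv f g x t)
    (continuous_const.mul (continuous_freeVelocityDeriv hf hg))
    (fun x t => (hasDerivAt_freeVelocity hf hg x t).const_mul ε) hC hle
  have cN : Continuous fun z : ℝ × ℝ => |m z.1 z.2| ^ p :=
    continuous_abs_rpow_comp (by linarith) cm
  have cN' : Continuous fun z : ℝ × ℝ => p * |m z.1 z.2| ^ (p - 2) * m z.1 z.2 * m' z.1 z.2 :=
    (continuous_powDeriv_comp hp cm).mul cm'
  have ck := continuous_div_weight a b (h := fun x t => |m x t| ^ p) cN
  have ck' := continuous_div_weight a b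
    (h := fun x t => p * |m x t| ^ (p - 2) * m x t * m' x t - logDerivWeight a b x t * |m x t| ^ p)
    (cN'.sub ((continuous_logDerivWeight a b).mul cN))
  have hd : ∀ x s, HasDerivAt (fun y => |m y s| ^ p / weight a b y s)
      ((p * |m x s| ^ (p - 2) * m x s * m' x s - logDerivWeight a b x s * |m x s| ^ p) /
        weight a b x s) x := fun x s =>
    HasDerivAt.div_weight (h := fun y => |m y s| ^ p)
      (HasDerivAt.comp (h := fun y => m y s) (h₂ := fun z => |z| ^ p) x
        (hasDerivAt_abs_rpow (m x s) (by linarith)) (hm' x s))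
  have h₁ : ∀ y, HasDerivAt (deriv f) (deriv (deriv f) y) y := fun y =>
    ((contDiff_one_deriv hf).differentiable one_ne_zero y).hasDerivAt
  have h₂ : ∀ y, HasDerivAt g (deriv g y) y := fun y =>
    (hg.differentiable one_ne_zero y).hasDerivAt
  have h₃ : ∀ y, HasDerivAt f (deriv f y) y := fun y =>
    (hf.differentiable two_ne_zero y).hasDerivAt
  have c₁ := (contDiff_one_deriv hf).continuous_deriv_one
  have c₂ := hg.continuous_deriv_one
  obtain ⟨u, w, v', w', hu, hu0, hut, hvt, hux, hwx, heq⟩ := exists_wave_solution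
    (φ := fun y => ε * f y) (A := fun y => ε * (g y + deriv f y))
    (B := fun y => ε * (g y - deriv f y))
    (fun y => ((h₂ y).add (h₁ y)).const_mul ε) (fun y => ((h₂ y).sub (h₁ y)).const_mul ε)
    (by fun_prop) (by fun_prop)
    (fun y => ((h₃ y).const_mul ε).congr_deriv (by ring)) ck ck' hd
    -- This velocity is defined for all times, so the linear theory applies on the whole plane. It
    -- agrees with `m` only for `t ∈ I`, which is where the nonlinear equation is claimed.
    (v := fun x t => ε * freeVelocity f g x t +
      duhamelVelocity a b (fun y s => |m y s| ^ p) x t)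
    (fun x t => by rw [duhamelVelocity_eq, freeVelocity]; ring)
  have hdu : ∀ x, EqOn (derivWithin (fun s => u x s) I) _ I := fun x =>
    derivWithin_eqOn hI (hut x)
  refine ⟨u, ⟨hu.contDiffOn, fun x t ht => ?_, hu0, fun x => ?_⟩⟩
  · have e₁ : iteratedDerivWithin 2 (fun s => u x s) I t = v' x t := by
      rw [iteratedDerivWithin_succ, iteratedDerivWithin_one,
        derivWithin_congr (hdu x) (hdu x ht)]
      exact derivWithin_eqOn hI (hvt x) ht
    have e₂ : iteratedDeriv 2 (fun y => u y t) x = w' x t := by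
      rw [iteratedDeriv_succ, iteratedDeriv_one]
      have : deriv (fun y => u y t) = fun y => w y t := funext fun y => (hux y t).deriv
      rw [this, (hwx x t).deriv]
    rw [e₁, e₂, heq, hdu x ht, ← H.picardLimit_eq x ht]
  · rw [hdu x h0]
    simp only [freeVelocity, duhamelVelocity, intervalIntegral.integral_same, add_zero, sub_zero]
    ring

theorem solutionExists (hf : ContDiff ℝ 2 f) (hg : ContDiff ℝ 1 g) (hI : UniqueDiffOn ℝ I)
    (H : IsContractive p a b I τ (fun x t => ε * freeVelocity f g x t) W M)
    (hW : ∀ x, ∀ t ∈ I, W x t ≠ 0 → |x| ≤ t + R) (hC : 0 ≤ C)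
    (hle : ∀ x, ∀ t ∈ I, |ε * freeVelocityDeriv f g x t| ≤ C * W x t) :
    SolutionExists p a b R ε f g I :=
  ⟨fun hp => H.exists_isClassicalSolution hf hg hI hp hC hle,
    fun _ => H.exists_isIntegralSolution hW⟩

end IsContractive

/-! ### Bounds for the weight; the envelope -/

/-- The sign of `c` is left open because `1 + a` and `1 + b` may have either sign; each sign uses
one of the two comparisons. -/
theorem rpow_neg_le_of_comparable {X Y k c : ℝ} (hk : 1 ≤ k) (hX : 0 < X) (hY : 0 < Y)
    (hYX : Y ≤ k * X) (hXY : X ≤ k * Y) : X ^ (-c) ≤ k ^ |c| * Y ^ (-c) := by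
  have hk0 : 0 < k := one_pos.trans_le hk
  rcases le_total 0 c with hc | hc
  · rw [abs_of_nonneg hc, Real.rpow_neg hX.le, Real.rpow_neg hY.le, ← div_eq_mul_inv,
      inv_le_comm₀ (Real.rpow_pos_of_pos hX _) (div_pos (Real.rpow_pos_of_pos hk0 _)
        (Real.rpow_pos_of_pos hY _)), inv_div, ← Real.div_rpow hY.le hk0.le]
    exact Real.rpow_le_rpow (by positivity) ((div_le_iff₀' hk0).2 hYX) hc
  · rw [abs_of_nonpos hc, ← Real.mul_rpow hk0.le hY.le]
    exact Real.rpow_le_rpow hX.le hXY (by linarith)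

theorem inv_weight_le (a b y : ℝ) {t : ℝ} (ht : 0 ≤ t) :
    (weight a b y t)⁻¹ ≤ 3 ^ (|1 + a| + |1 + b|) *
      ((1 + t + |y|) ^ (-(1 + a)) * (1 + |(t - |y|)|) ^ (-(1 + b))) := by
  have hy := abs_nonneg y
  have h₁ := abs_le_bracket y
  have h₂ := bracket_le y
  have hX := bracket_pos (t + bracket y)
  have hZ := bracket_pos (t - bracket y)
  have hX₁ := one_le_bracket (t + bracket y)
  have hZ₁ := one_le_bracket (t - bracket y)
  have hX₂ := (le_abs_self _).trans (abs_le_bracket (t + bracket y))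
  have hZ₂ := abs_le_bracket (t - bracket y)
  have hX₃ := bracket_le (t + bracket y)
  have hZ₃ := bracket_le (t - bracket y)
  rw [abs_of_nonneg (by linarith)] at hX₃
  -- Replacing `⟨y⟩` by `|y|` shifts the arguments by at most one. As brackets are at least one,
  -- such shifts cost at most the factor `3` on either side.
  have hd : |(t - bracket y) - (t - |y|)| ≤ 1 := abs_le.2 ⟨by linarith, by linarith⟩
  have hd₁ := abs_sub_abs_le_abs_sub (t - bracket y) (t - |y|)
  have hd₂ := abs_sub_abs_le_abs_sub (t - |y|) (t - bracket y)
  rw [abs_sub_comm (t - |y|) (t - bracket y)] at hd₂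
  have hQ := abs_nonneg (t - |y|)
  have e : (weight a b y t)⁻¹ =
      bracket (t + bracket y) ^ (-(1 + a)) * bracket (t - bracket y) ^ (-(1 + b)) := by
    rw [weight, mul_inv, Real.rpow_neg hX.le, Real.rpow_neg hZ.le]
  rw [e, Real.rpow_add three_pos, mul_mul_mul_comm]
  exact mul_le_mul
    (rpow_neg_le_of_comparable (by norm_num) hX (by linarith) (by linarith) (by linarith))
    (rpow_neg_le_of_comparable (by norm_num) hZ (by linarith) (by linarith) (by linarith))
    (Real.rpow_nonneg hZ.le _) (by positivity)

/-- The kernel `(1 + |s|)^(-γ)`. -/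
def kern (γ s : ℝ) : ℝ := (1 + |s|) ^ (-γ)

theorem kern_pos (γ s : ℝ) : 0 < kern γ s := Real.rpow_pos_of_pos (by positivity) _

theorem continuous_kern (γ : ℝ) : Continuous (kern γ) :=
  Continuous.rpow_const (f := fun s : ℝ => 1 + |s|) (by fun_prop) fun s => .inl (by positivity)

theorem integral_kern_nonneg (γ : ℝ) {X : ℝ} (hX : 0 ≤ X) : 0 ≤ ∫ s in (0 : ℝ)..X, kern γ s :=
  intervalIntegral.integral_nonneg hX fun s _ => (kern_pos γ s).le

theorem integral_kern_mono (γ : ℝ) {l r X : ℝ} (hl : 0 ≤ l) (hlr : l ≤ r) (hr : r ≤ X) :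
    ∫ s in l..r, kern γ s ≤ ∫ s in (0 : ℝ)..X, kern γ s :=
  intervalIntegral.integral_mono_interval hl hlr hr
    (Eventually.of_forall fun s => (kern_pos γ s).le) ((continuous_kern γ).intervalIntegrable _ _)

/-- The pointwise bound for the solution: `η` near the light cone `|x| = t`,
`B (1 + t - |x|)^(-α)` inside the cone, and zero outside the domain of influence. -/
def envelope (R η B α x t : ℝ) : ℝ :=
  if t + R < |x| then 0 else if t - |x| ≤ R then η else B * (1 + (t - |x|)) ^ (-α)

variable {R η B α : ℝ}

theorem envelope_of_lt {x t : ℝ} (h : t + R < |x|) : envelope R η B α x t = 0 := if_pos h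

theorem envelope_of_le {x t : ℝ} (h : |x| ≤ t + R) (h' : t - |x| ≤ R) :
    envelope R η B α x t = η := by rw [envelope, if_neg h.not_gt, if_pos h']

theorem envelope_of_gt {x t : ℝ} (hR : 0 ≤ R) (h : R < t - |x|) :
    envelope R η B α x t = B * (1 + (t - |x|)) ^ (-α) := by
  rw [envelope, if_neg (by linarith), if_neg h.not_ge]

theorem envelope_nonneg (hR : 0 ≤ R) (hη : 0 ≤ η) (hB : 0 ≤ B) (x t : ℝ) :
    0 ≤ envelope R η B α x t := by
  unfold envelope
  split_ifs with h₁ h₂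
  · exact le_rfl
  · exact hη
  · exact mul_nonneg hB (Real.rpow_nonneg (by linarith) _)

theorem envelope_le (hR : 0 ≤ R) (hη : 0 ≤ η) (hB : 0 ≤ B) (hα : 0 ≤ α) (x t : ℝ) :
    envelope R η B α x t ≤ η + B := by
  unfold envelope
  split_ifs with h₁ h₂
  · linarith
  · linarith
  · have := Real.rpow_le_one_of_one_le_of_nonpos (x := 1 + (t - |x|)) (by linarith)
      (neg_nonpos.2 hα)
    nlinarith

theorem envelope_neg (R η B α x t : ℝ) :
    envelope R η B α (-x) t = envelope R η B α x t := by simp [envelope]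

/-! ### Integration of an enveloped source along a characteristic -/

/-- Pointwise bounds for a source along the characteristic `x - t = -ξ`. -/
structure IsEnveloped (p α γ R η B K : ℝ) (I : Set ℝ) (k : ℝ → ℝ → ℝ) : Prop where
  continuous : Continuous fun z : ℝ × ℝ => k z.1 z.2
  outside : ∀ y, ∀ s ∈ I, s + R < |y| → k y s = 0
  near : ∀ y, ∀ s ∈ I, |y| ≤ s + R → s - |y| ≤ R →
    |k y s| ≤ K * (1 + R) ^ |γ| * η ^ p * (1 + s + |y|) ^ (-α)
  inside : ∀ y, ∀ s ∈ I, R < s - |y| →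
    |k y s| ≤ K * B ^ p * ((1 + s + |y|) ^ (-α) * (1 + (s - |y|)) ^ (-(γ + p * α)))

theorem isEnveloped_div_weight {p a b K γ : ℝ} {I : Set ℝ} {h : ℝ → ℝ → ℝ} (hp : 1 < p)
    (hR : 0 ≤ R) (hη : 0 ≤ η) (hB : 0 ≤ B) (hK : 0 ≤ K)
    (hw : ∀ y, ∀ s ∈ I, |y| ≤ s + R →
      (weight a b y s)⁻¹ ≤ K * ((1 + s + |y|) ^ (-α) * (1 + |(s - |y|)|) ^ (-γ)))
    (hI : ∀ t ∈ I, 0 ≤ t) (hh : Continuous fun z : ℝ × ℝ => h z.1 z.2)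
    (hle : ∀ y, ∀ s ∈ I, |h y s| ≤ envelope R η B α y s ^ p) :
    IsEnveloped p α γ R η B K I fun y s => h y s / weight a b y s := by
  have habs (y s : ℝ) : |h y s / weight a b y s| = |h y s| * (weight a b y s)⁻¹ := by
    rw [abs_div, abs_of_pos (weight_pos a b y s), div_eq_mul_inv]
  refine ⟨continuous_div_weight a b hh, fun y s hs hy => ?_, fun y s hs hy hys => ?_,
    fun y s hs hy => ?_⟩
  · have h₁ := hle y s hs
    rw [envelope_of_lt hy, Real.zero_rpow (by linarith), abs_nonpos_iff] at h₁
    rw [h₁, zero_div]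
  · have h₁ := hle y s hs
    rw [envelope_of_le hy hys] at h₁
    have h₀ := hI s hs
    have hP : 0 ≤ (1 + s + |y|) ^ (-α) := Real.rpow_nonneg (by positivity) _
    -- In the strip `s - |y|` is bounded by `R`, so this factor is bounded whatever the sign of `γ`.
    have hQ : (1 + |(s - |y|)|) ^ (-γ) ≤ (1 + R) ^ |γ| := by
      have hQR : |(s - |y|)| ≤ R := abs_le.2 ⟨by linarith, hys⟩
      have h₁ : (1 : ℝ) ≤ 1 + |(s - |y|)| := by linarith [abs_nonneg (s - |y|)]
      calc (1 + |(s - |y|)|) ^ (-γ) ≤ (1 + |(s - |y|)|) ^ |γ| :=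
            Real.rpow_le_rpow_of_exponent_le h₁ (neg_le_abs γ)
        _ ≤ _ := Real.rpow_le_rpow (by linarith) (by linarith) (abs_nonneg γ)
    rw [habs]
    calc _ ≤ η ^ p * (K * ((1 + s + |y|) ^ (-α) * (1 + R) ^ |γ|)) :=
          mul_le_mul h₁ ((hw y s hs hy).trans (mul_le_mul_of_nonneg_left
            (mul_le_mul_of_nonneg_left hQ hP) hK)) (inv_pos.2 (weight_pos a b y s)).le
            (Real.rpow_nonneg hη _)
      _ = _ := by ring
  · have h₁ := hle y s hs
    rw [envelope_of_gt hR hy] at h₁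
    have h₀ : 0 < 1 + (s - |y|) := by linarith
    have h₂ := hw y s hs (by linarith)
    rw [abs_of_pos (by linarith : 0 < s - |y|)] at h₂
    rw [habs]
    calc _ ≤ (B * (1 + (s - |y|)) ^ (-α)) ^ p *
          (K * ((1 + s + |y|) ^ (-α) * (1 + (s - |y|)) ^ (-γ))) :=
          mul_le_mul h₁ h₂ (inv_pos.2 (weight_pos a b y s)).le
            (Real.rpow_nonneg (mul_nonneg hB (Real.rpow_nonneg h₀.le _)) _)
      _ = _ := by
          rw [Real.mul_rpow hB (Real.rpow_nonneg h₀.le _), ← Real.rpow_mul h₀.le,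
            show -(γ + p * α) = -α * p + -γ by ring, Real.rpow_add h₀]
          ring

namespace IsEnveloped

variable {p γ K : ℝ} {I : Set ℝ} {k : ℝ → ℝ → ℝ}

/-- Reflection exchanges the two families of characteristics, so only the slope `-1` has to be
treated. -/
theorem reflect (H : IsEnveloped p α γ R η B K I k) :
    IsEnveloped p α γ R η B K I fun y s => k (-y) s := by
  have hc : Continuous fun z : ℝ × ℝ => (-z.1, z.2) := by fun_prop
  refine ⟨H.continuous.comp hc, fun y s hs h => H.outside (-y) s hs (by rwa [abs_neg]),
    fun y s hs h h' => ?_, fun y s hs h => ?_⟩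
  · simpa using H.near (-y) s hs (by rwa [abs_neg]) (by rwa [abs_neg])
  · simpa using H.inside (-y) s hs (by rwa [abs_neg])

theorem eq_zero_of_lt (H : IsEnveloped p α γ R η B K I k) {ξ s : ℝ} (hs : s ∈ I)
    (h : ξ < -R ∨ 2 * s - ξ < -R) : k (s - ξ) s = 0 := by
  refine H.outside _ s hs (lt_abs.2 ?_)
  rcases h with h | h
  · exact .inl (by linarith)
  · exact .inr (by linarith)

/-- On a ray with `ξ ≤ R` one has `s - |s - ξ| ≤ ξ ≤ R` at all times, so it never enters the
interior region. -/
theorem near_right (H : IsEnveloped p α γ R η B K I k) (hα : 0 ≤ α) (hK : 0 ≤ K) (hη : 0 ≤ η)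
    (hR : 0 ≤ R) {ξ s : ℝ} (hs : s ∈ I) (hs0 : 0 ≤ s) (hξ : ξ ≤ R) :
    |k (s - ξ) s| ≤ K * (1 + R) ^ |γ| * η ^ p * kern α s := by
  have hD : 0 ≤ K * (1 + R) ^ |γ| * η ^ p := by positivity
  by_cases h : ξ < -R ∨ 2 * s - ξ < -R
  · rw [H.eq_zero_of_lt hs h, abs_zero]
    exact mul_nonneg hD (kern_pos α s).le
  · push Not at h
    refine (H.near _ s hs (abs_le.2 ⟨by linarith, by linarith⟩) ?_).trans
      (mul_le_mul_of_nonneg_left ?_ hD)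
    · linarith [le_abs_self (s - ξ)]
    · rw [kern, abs_of_nonneg hs0]
      exact Real.rpow_le_rpow_of_nonpos (by linarith) (by linarith [abs_nonneg (s - ξ)])
        (by linarith)

/-- Where the ray crosses the strip around `x = -t`, the quantity `s + |y|` is at least `ξ`. This is
the source of the interior decay `(1 + ξ)^(-α)`. -/
theorem near_left (H : IsEnveloped p α γ R η B K I k) (hα : 0 ≤ α) (hK : 0 ≤ K) (hη : 0 ≤ η)
    (hR : 0 ≤ R) {ξ s : ℝ} (hs : s ∈ I) (hξ : R < ξ) (h₁ : -R ≤ 2 * s - ξ) (h₂ : 2 * s - ξ ≤ R) :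
    |k (s - ξ) s| ≤ K * (1 + R) ^ |γ| * η ^ p * (1 + ξ) ^ (-α) := by
  have hy := neg_le_abs (s - ξ)
  refine (H.near _ s hs (abs_le.2 ⟨by linarith, by linarith⟩) (by linarith)).trans
    (mul_le_mul_of_nonneg_left ?_ (by positivity))
  exact Real.rpow_le_rpow_of_nonpos (by linarith) (by linarith) (by linarith)

/-- The purpose is to extract the decay in `ξ` from a product whose exponents are attached to the
wrong variables. The surplus `(1+ξ)^(α-β)` is at most `(1+σ)^(α-β)` if `β ≤ α`, and at most one
otherwise. -/
theorem rpow_mul_rpow_le {ξ σ α β : ℝ} (hξ : 0 ≤ ξ) (hξσ : ξ ≤ σ) :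
    (1 + σ) ^ (-α) * (1 + ξ) ^ (-β) ≤
      (1 + ξ) ^ (-α) * ((1 + σ) ^ (-β) + (1 + σ) ^ (-α)) := by
  have h₁ : 0 < 1 + ξ := by linarith
  have h₂ : 0 < 1 + σ := by linarith
  have e : (1 + σ) ^ (-α) * (1 + ξ) ^ (-β) =
      (1 + ξ) ^ (-α) * ((1 + ξ) ^ (α - β) * (1 + σ) ^ (-α)) := by
    rw [← mul_assoc, ← Real.rpow_add h₁, mul_comm]
    congr 2; ring
  rw [e]
  refine mul_le_mul_of_nonneg_left ?_ (Real.rpow_nonneg h₁.le _)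
  rcases le_total β α with h | h
  · have h₃ : (1 + ξ) ^ (α - β) ≤ (1 + σ) ^ (α - β) :=
      Real.rpow_le_rpow h₁.le (by linarith) (by linarith)
    calc _ ≤ (1 + σ) ^ (α - β) * (1 + σ) ^ (-α) :=
          mul_le_mul_of_nonneg_right h₃ (Real.rpow_nonneg h₂.le _)
      _ = (1 + σ) ^ (-β) := by rw [← Real.rpow_add h₂]; congr 1; ring
      _ ≤ _ := le_add_of_nonneg_right (Real.rpow_nonneg h₂.le _)
  · have h₃ : (1 + ξ) ^ (α - β) ≤ 1 :=
      Real.rpow_le_one_of_one_le_of_nonpos (by linarith) (by linarith)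
    calc _ ≤ 1 * (1 + σ) ^ (-α) := mul_le_mul_of_nonneg_right h₃ (Real.rpow_nonneg h₂.le _)
      _ ≤ _ := by rw [one_mul]; exact le_add_of_nonneg_left (Real.rpow_nonneg h₂.le _)

/-- With `σ = 2s - ξ`, the pair `(s + |y|, s - |y|)` is `(ξ, σ)` until the ray reaches `y = 0`, and
`(σ, ξ)` afterwards. The second stage needs `rpow_mul_rpow_le`, which accounts for the additional
kernel of exponent `α`. -/
theorem inside_left (H : IsEnveloped p α γ R η B K I k) (hK : 0 ≤ K) (hB : 0 ≤ B)
    (hR : 0 ≤ R) {ξ s : ℝ} (hs : s ∈ I) (hξ : R < ξ) (h : R < 2 * s - ξ) :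
    |k (s - ξ) s| ≤ K * B ^ p * (1 + ξ) ^ (-α) *
      (kern (γ + p * α) (2 * s - ξ) + kern α (2 * s - ξ)) := by
  have hKB : 0 ≤ K * B ^ p := by positivity
  have hσ : |2 * s - ξ| = 2 * s - ξ := abs_of_pos (by linarith)
  simp only [kern, hσ]
  rw [mul_assoc]
  rcases le_total s ξ with hsξ | hsξ
  · have hy : |s - ξ| = ξ - s := by rw [abs_of_nonpos (by linarith)]; ring
    have h₁ := H.inside _ s hs (by rw [hy]; linarith)
    rw [hy, show 1 + s + (ξ - s) = 1 + ξ by ring, show s - (ξ - s) = 2 * s - ξ by ring] at h₁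
    refine h₁.trans (mul_le_mul_of_nonneg_left (mul_le_mul_of_nonneg_left ?_ ?_) hKB)
    · exact le_add_of_nonneg_right (Real.rpow_nonneg (by linarith) _)
    · exact Real.rpow_nonneg (by linarith) _
  · have hy : |s - ξ| = s - ξ := abs_of_nonneg (by linarith)
    have h₁ := H.inside _ s hs (by rw [hy]; linarith)
    rw [hy, show 1 + s + (s - ξ) = 1 + (2 * s - ξ) by ring, sub_sub_cancel] at h₁
    exact h₁.trans (mul_le_mul_of_nonneg_left
      (rpow_mul_rpow_le (by linarith) (by linarith)) hKB)

end IsEnveloped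

namespace IsEnveloped

variable {p α γ R η B K A₁ A₂ δ : ℝ} {I : Set ℝ} {k : ℝ → ℝ → ℝ}

theorem intervalIntegrable (H : IsEnveloped p α γ R η B K I k) (ξ l r : ℝ) :
    IntervalIntegrable (fun s => k (s - ξ) s) volume l r := by
  have : Continuous fun s : ℝ => (s - ξ, s) := by fun_prop
  exact (H.continuous.comp this).intervalIntegrable l r

theorem integral_eq_zero (H : IsEnveloped p α γ R η B K I k) {ξ r : ℝ} (hr : 0 ≤ r)
    (hI : ∀ s, 0 ≤ s → s ≤ r → s ∈ I) (h : ξ < -R ∨ 2 * r - ξ ≤ -R) :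
    ∫ s in (0 : ℝ)..r, k (s - ξ) s = 0 := by
  refine intervalIntegral.integral_zero_ae ?_
  -- The source is known to vanish only strictly outside the domain of influence. The final time may
  -- lie on its boundary and is discarded as a null set.
  filter_upwards [(countable_singleton r).ae_notMem volume] with s hsr hs
  rw [uIoc_of_le hr] at hs
  refine H.eq_zero_of_lt (hI s hs.1.le hs.2) (h.imp id fun h => ?_)
  have : s < r := lt_of_le_of_ne hs.2 hsr
  linarith

theorem abs_integral_right_le (H : IsEnveloped p α γ R η B K I k) (hα : 0 ≤ α) (hK : 0 ≤ K)
    (hη : 0 ≤ η) (hR : 0 ≤ R) {ξ t : ℝ} (ht : 0 ≤ t) (hI : ∀ s, 0 ≤ s → s ≤ t → s ∈ I)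
    (hξ : ξ ≤ R) (hA₁ : ∫ s in (0 : ℝ)..(2 * t), kern α s ≤ A₁) :
    |∫ s in (0 : ℝ)..t, k (s - ξ) s| ≤ K * (1 + R) ^ |γ| * η ^ p * A₁ := by
  have h := intervalIntegral.norm_integral_le_of_norm_le (μ := volume) ht
    (f := fun s => k (s - ξ) s) (g := fun s => K * (1 + R) ^ |γ| * η ^ p * kern α s)
    (Eventually.of_forall fun s hs => H.near_right hα hK hη hR (hI s hs.1.le hs.2) hs.1.le hξ)
    (((continuous_kern α).const_mul _).intervalIntegrable _ _)
  rw [intervalIntegral.integral_const_mul] at h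
  exact h.trans (mul_le_mul_of_nonneg_left
    ((integral_kern_mono α le_rfl ht (by linarith)).trans hA₁) (by positivity))

theorem abs_integral_left_le (H : IsEnveloped p α γ R η B K I k) (hα : 0 ≤ α) (hK : 0 ≤ K)
    (hη : 0 ≤ η) (hR : 0 ≤ R) {ξ r : ℝ} (hξ : R < ξ) (hI : ∀ s, 0 ≤ s → s ≤ r → s ∈ I)
    (h₁ : -R ≤ 2 * r - ξ) (h₂ : 2 * r - ξ ≤ R) :
    |∫ s in (0 : ℝ)..r, k (s - ξ) s| ≤ K * (1 + R) ^ |γ| * η ^ p * R * (1 + ξ) ^ (-α) := by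
  -- At time `l` the ray enters the domain of influence; it then stays in the left strip for a time
  -- of length at most `R`.
  set l := (ξ - R) / 2 with hl
  have hl0 : 0 ≤ l := by linarith
  have hlr : l ≤ r := by linarith
  rw [← intervalIntegral.integral_add_adjacent_intervals (H.intervalIntegrable ξ 0 l)
    (H.intervalIntegrable ξ l r), H.integral_eq_zero hl0
    (fun s hs hs' => hI s hs (hs'.trans hlr)) (.inr (by linarith)), zero_add]
  have h := intervalIntegral.norm_integral_le_of_norm_le_const (a := l) (b := r)
    (f := fun s => k (s - ξ) s) (C := K * (1 + R) ^ |γ| * η ^ p * (1 + ξ) ^ (-α)) (fun s hs => by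
      rw [uIoc_of_le hlr] at hs
      exact H.near_left hα hK hη hR (hI s (hl0.trans hs.1.le) hs.2) hξ (by linarith [hs.1])
        (by linarith [hs.2]))
  rw [abs_of_nonneg (sub_nonneg.2 hlr)] at h
  have h0 : 0 ≤ K * (1 + R) ^ |γ| * η ^ p * (1 + ξ) ^ (-α) :=
    mul_nonneg (by positivity) (Real.rpow_nonneg (by linarith) _)
  refine h.trans ((mul_le_mul_of_nonneg_left (by linarith : r - l ≤ R) h0).trans_eq (by ring))

theorem abs_integral_inside_le (H : IsEnveloped p α γ R η B K I k) (hK : 0 ≤ K) (hB : 0 ≤ B)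
    (hR : 0 ≤ R) {ξ r t : ℝ} (hξ : R < ξ) (hI : ∀ s, 0 ≤ s → s ≤ t → s ∈ I)
    (hr : 2 * r - ξ = R) (hrt : r ≤ t) (hA₁ : ∫ s in (0 : ℝ)..(2 * t), kern α s ≤ A₁)
    (hA₂ : ∫ s in (0 : ℝ)..(2 * t), kern (γ + p * α) s ≤ A₂) :
    |∫ s in r..t, k (s - ξ) s| ≤ K * B ^ p * (A₁ + A₂) * (1 + ξ) ^ (-α) := by
  have hr0 : 0 ≤ r := by linarith
  have c₁ : Continuous fun s : ℝ => kern (γ + p * α) (2 * s - ξ) :=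
    (continuous_kern _).comp (by fun_prop)
  have c₂ : Continuous fun s : ℝ => kern α (2 * s - ξ) := (continuous_kern _).comp (by fun_prop)
  have h := intervalIntegral.norm_integral_le_of_norm_le (μ := volume) hrt
    (f := fun s => k (s - ξ) s) (g := fun s => K * B ^ p * (1 + ξ) ^ (-α) *
      (kern (γ + p * α) (2 * s - ξ) + kern α (2 * s - ξ)))
    (Eventually.of_forall fun s hs => H.inside_left hK hB hR
      (hI s (hr0.trans hs.1.le) hs.2) hξ (by linarith [hs.1]))
    (((c₁.add c₂).const_mul _).intervalIntegrable _ _)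
  have key (c A : ℝ) (hA : ∫ s in (0 : ℝ)..(2 * t), kern c s ≤ A) :
      ∫ s in r..t, kern c (2 * s - ξ) ≤ A := by
    -- The variable `σ = 2s - ξ` runs inside `[0, 2t]`, which is why the kernel integrals are taken
    -- up to `2t`. The Jacobian `1/2` is given away.
    rw [intervalIntegral.integral_comp_mul_sub _ two_ne_zero, smul_eq_mul]
    have h₁ := integral_kern_mono c (l := 2 * r - ξ) (r := 2 * t - ξ) (X := 2 * t) (by linarith)
      (by linarith) (by linarith)
    have h₂ := integral_kern_nonneg c (X := 2 * t) (by linarith)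
    linarith
  have h0 : 0 ≤ K * B ^ p * (1 + ξ) ^ (-α) :=
    mul_nonneg (by positivity) (Real.rpow_nonneg (by linarith) _)
  rw [intervalIntegral.integral_const_mul, intervalIntegral.integral_add
    (c₁.intervalIntegrable _ _) (c₂.intervalIntegrable _ _)] at h
  refine h.trans ((mul_le_mul_of_nonneg_left
    (add_le_add (key _ _ hA₂) (key _ _ hA₁)) h0).trans_eq (by ring))

/-- The ray is `s ↦ (s - ξ, s)` with `ξ = t - x`. Its endpoint lies outside the domain of influence,
on a ray with `ξ ≤ R`, in the left strip, or in the interior; `h₁` serves the second case, `h₂` the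
third, and `h₃`, `h₄` contribute half of the bound each in the last. -/
theorem abs_rayIntegral_le (H : IsEnveloped p α γ R η B K I k) (hα : 0 ≤ α) (hK : 0 ≤ K)
    (hη : 0 ≤ η) (hB : 0 ≤ B) (hR : 0 ≤ R) (hδ : 0 ≤ δ) {x t : ℝ} (ht : 0 ≤ t)
    (hI : ∀ s, 0 ≤ s → s ≤ t → s ∈ I)
    (hA₁ : ∫ s in (0 : ℝ)..(2 * t), kern α s ≤ A₁)
    (hA₂ : ∫ s in (0 : ℝ)..(2 * t), kern (γ + p * α) s ≤ A₂)
    (h₁ : K * (1 + R) ^ |γ| * η ^ p * A₁ ≤ δ * η) (h₂ : K * (1 + R) ^ |γ| * η ^ p * R ≤ δ * η)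
    (h₃ : K * (1 + R) ^ |γ| * η ^ p * R ≤ δ * B / 2) (h₄ : K * B ^ p * (A₁ + A₂) ≤ δ * B / 2) :
    |rayIntegral (-1) k x t| ≤ δ * envelope R η B α x t := by
  have e : rayIntegral (-1) k x t = ∫ s in (0 : ℝ)..t, k (s - (t - x)) s := by
    unfold rayIntegral
    congr 1; funext s; congr 1; ring
  rw [e]
  generalize hξ : t - x = ξ
  obtain rfl : x = t - ξ := by linarith
  by_cases hout : t + R < |t - ξ|
  · rw [H.integral_eq_zero ht hI, abs_zero]
    · exact mul_nonneg hδ (envelope_nonneg hR hη hB _ _)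
    · rcases lt_abs.1 hout with h | h
      · exact .inl (by linarith)
      · exact .inr (by linarith)
  push Not at hout
  obtain ⟨ho₁, ho₂⟩ := abs_le.1 hout
  rcases le_or_gt ξ R with hξR | hξR
  · rw [envelope_of_le hout (by linarith [le_abs_self (t - ξ)])]
    exact (H.abs_integral_right_le hα hK hη hR ht hI hξR hA₁).trans h₁
  have hQ₀ : 0 ≤ (1 + ξ) ^ (-α) := Real.rpow_nonneg (by linarith) _
  have hQ₁ : (1 + ξ) ^ (-α) ≤ 1 :=
    Real.rpow_le_one_of_one_le_of_nonpos (by linarith) (by linarith)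
  rcases le_or_gt (2 * t - ξ) R with hσ | hσ
  · rw [envelope_of_le hout (by linarith [neg_le_abs (t - ξ)])]
    refine (H.abs_integral_left_le hα hK hη hR hξR hI (by linarith) hσ).trans ?_
    exact (mul_le_of_le_one_right (by positivity) hQ₁).trans h₂
  · have hin : R < t - |t - ξ| := by
      rw [lt_sub_iff_add_lt, ← lt_sub_iff_add_lt', abs_lt]
      constructor <;> linarith
    rw [envelope_of_gt hR hin]
    -- The time at which the ray leaves the left strip for the interior.
    set r := (ξ + R) / 2 with hr
    have hrt : r ≤ t := by linarith
    have i₁ := H.abs_integral_left_le hα hK hη hR hξR (r := r)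
      (fun s hs hs' => hI s hs (hs'.trans hrt)) (by linarith) (by linarith)
    have i₂ := H.abs_integral_inside_le hK hB hR hξR hI (r := r) (by linarith) hrt hA₁ hA₂
    rw [← intervalIntegral.integral_add_adjacent_intervals (H.intervalIntegrable ξ 0 r)
      (H.intervalIntegrable ξ r t)]
    have hQ : (1 + ξ) ^ (-α) ≤ (1 + (t - |t - ξ|)) ^ (-α) :=
      Real.rpow_le_rpow_of_nonpos (by linarith)
        (by linarith [neg_le_abs (t - ξ), le_abs_self (t - ξ)])
        (by linarith)
    have i₃ := mul_le_mul_of_nonneg_right h₃ hQ₀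
    have i₄ := mul_le_mul_of_nonneg_right h₄ hQ₀
    calc _ ≤ _ := abs_add_le _ _
      _ ≤ δ * B * (1 + ξ) ^ (-α) := by linarith
      _ ≤ δ * B * (1 + (t - |t - ξ|)) ^ (-α) := mul_le_mul_of_nonneg_left hQ (by positivity)
      _ = _ := by ring

theorem abs_half_add_half_le (H : IsEnveloped p α γ R η B K I k) (hα : 0 ≤ α) (hK : 0 ≤ K)
    (hη : 0 ≤ η) (hB : 0 ≤ B) (hR : 0 ≤ R) (hδ : 0 ≤ δ) {x t : ℝ} (ht : 0 ≤ t)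
    (hI : ∀ s, 0 ≤ s → s ≤ t → s ∈ I)
    (hA₁ : ∫ s in (0 : ℝ)..(2 * t), kern α s ≤ A₁)
    (hA₂ : ∫ s in (0 : ℝ)..(2 * t), kern (γ + p * α) s ≤ A₂)
    (h₁ : K * (1 + R) ^ |γ| * η ^ p * A₁ ≤ δ * η) (h₂ : K * (1 + R) ^ |γ| * η ^ p * R ≤ δ * η)
    (h₃ : K * (1 + R) ^ |γ| * η ^ p * R ≤ δ * B / 2) (h₄ : K * B ^ p * (A₁ + A₂) ≤ δ * B / 2) :
    |(1 / 2) * rayIntegral 1 k x t + (1 / 2) * rayIntegral (-1) k x t| ≤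
      δ * envelope R η B α x t := by
  have i₁ := H.abs_rayIntegral_le hα hK hη hB hR hδ (x := x) ht hI hA₁ hA₂ h₁ h₂ h₃ h₄
  have i₂ := H.reflect.abs_rayIntegral_le hα hK hη hB hR hδ (x := -x) ht hI hA₁ hA₂ h₁ h₂ h₃ h₄
  have e : rayIntegral (-1) (fun y s => k (-y) s) (-x) t = rayIntegral 1 k x t := by
    unfold rayIntegral
    refine intervalIntegral.integral_congr fun s _ => ?_
    dsimp only
    congr 1; ring
  rw [e, envelope_neg] at i₂
  rw [abs_le] at *
  constructor <;> linarith [i₁.1, i₁.2, i₂.1, i₂.2]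

end IsEnveloped

/-! ### Size of the data and the existence criterion -/

/-- The free velocity is supported near the light cone. -/
theorem abs_travel_le {R C t x : ℝ} {A B : ℝ → ℝ} (hA : ∀ y, |A y| ≤ C) (hB : ∀ y, |B y| ≤ C)
    (hA₀ : ∀ y, R < |y| → A y = 0) (hB₀ : ∀ y, R < |y| → B y = 0) (ht : 0 ≤ t) {η E α c : ℝ}
    (hR : 0 ≤ R) (hη : 0 ≤ η) (hE : 0 ≤ E) (hc : 0 ≤ c) (hC : C ≤ c * η) :
    |(1 / 2) * (A (x + t) + B (x - t))| ≤ c * envelope R η E α x t := by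
  by_cases h : |x| ≤ t + R ∧ t - |x| ≤ R
  · rw [envelope_of_le h.1 h.2]
    have h₁ := abs_le.1 (hA (x + t))
    have h₂ := abs_le.1 (hB (x - t))
    rw [abs_le]
    constructor <;> linarith [h₁.1, h₁.2, h₂.1, h₂.2]
  · have h' : ∀ y, |(|x| - t)| ≤ |y| → R < |y| := fun y hy => by
      refine lt_of_lt_of_le ?_ hy
      rw [lt_abs]
      by_contra hcon
      push Not at hcon
      exact h ⟨by linarith, by linarith⟩
    have e₁ : A (x + t) = 0 := hA₀ _ (h' _ (by
      have := abs_abs_sub_abs_le_abs_sub x (-t)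
      rwa [abs_neg, abs_of_nonneg ht, sub_neg_eq_add] at this))
    have e₂ : B (x - t) = 0 := hB₀ _ (h' _ (by
      have := abs_abs_sub_abs_le_abs_sub x t
      rwa [abs_of_nonneg ht] at this))
    rw [e₁, e₂, add_zero, mul_zero, abs_zero]
    exact mul_nonneg hc (envelope_nonneg hR hη hE _ _)

/-- The smallness conditions that make the fixed point problem a contraction for the envelope
follow from two conditions on `Θ η^(p-1)`. -/
theorem exists_envelope_conditions {p R D K : ℝ} (hp : 1 < p) (hR : 1 ≤ R) (hD : 1 ≤ D)
    (hK : 0 < K) :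
    ∃ κ : ℝ, 0 < κ ∧ ∀ η Θ A₁ A₂ : ℝ, 0 < η → 1 ≤ Θ → 1 ≤ A₁ → 0 ≤ A₂ →
      Θ * η ^ (p - 1) * A₁ ≤ κ → (Θ * η ^ (p - 1)) ^ p * A₂ ≤ κ →
      ∃ B : ℝ, 0 ≤ B ∧ K * Θ * D * η ^ p * A₁ ≤ 1 / (2 * p) * η ∧
        K * Θ * D * η ^ p * R ≤ 1 / (2 * p) * η ∧
        K * Θ * D * η ^ p * R ≤ 1 / (2 * p) * B / 2 ∧
        K * Θ * B ^ p * (A₁ + A₂) ≤ 1 / (2 * p) * B / 2 := by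
  set c := 4 * p * R * K * D with hc
  have hc0 : 0 < c := by positivity
  set L := K * c ^ (p - 1) with hL
  have hL0 : 0 < L := by positivity
  refine ⟨min 1 (min (1 / (2 * p) / (K * D * R)) (1 / (8 * p) / L)), by positivity,
    fun η Θ A₁ A₂ hη hΘ hA₁ hA₂ h₁ h₂ => ?_⟩
  set m := Θ * η ^ (p - 1) with hm
  have hm0 : 0 < m := by positivity
  have k₁ : m * A₁ ≤ 1 := h₁.trans (min_le_left _ _)
  have k₂ : m * A₁ ≤ 1 / (2 * p) / (K * D * R) :=
    h₁.trans ((min_le_right _ _).trans (min_le_left _ _))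
  have k₃ : m * A₁ ≤ 1 / (8 * p) / L := h₁.trans ((min_le_right _ _).trans (min_le_right _ _))
  have k₄ : m ^ p * A₂ ≤ 1 / (8 * p) / L :=
    h₂.trans ((min_le_right _ _).trans (min_le_right _ _))
  -- The interior estimate also involves `A₁`, but the strip condition is the stronger one, because
  -- `m ≤ 1`.
  have k₅ : m ^ p * A₁ ≤ m * A₁ := by
    have hm1 : m ≤ 1 := by nlinarith
    exact mul_le_mul_of_nonneg_right
      (by simpa using Real.rpow_le_rpow_of_exponent_ge hm0 hm1 hp.le) (by linarith)
  have e₁ : Θ * η ^ p = m * η := by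
    rw [hm, mul_assoc, ← Real.rpow_add_one hη.ne', sub_add_cancel]
  have hmA : m ≤ m * A₁ := le_mul_of_one_le_right hm0.le hA₁
  rw [le_div_iff₀ (by positivity)] at k₂ k₃ k₄
  have hR₁ : m * A₁ * (K * D) ≤ 1 / (2 * p) := by
    have : m * A₁ * (K * D) ≤ m * A₁ * (K * D * R) :=
      mul_le_mul_of_nonneg_left (le_mul_of_one_le_right (by positivity) hR) (by positivity)
    linarith
  have hR₂ : m * (K * D * R) ≤ 1 / (2 * p) := by
    have : m * (K * D * R) ≤ m * A₁ * (K * D * R) :=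
      mul_le_mul_of_nonneg_right hmA (by positivity)
    linarith
  -- `B = c Θ η^p` is the size of what the strip radiates into the interior, with `c` making the
  -- third condition an equality. Then `Θ B^(p-1) = c^(p-1) m^p`, which is how `m^p` enters the
  -- second hypothesis.
  refine ⟨c * (m * η), by positivity, ?_, ?_, ?_, ?_⟩
  · calc _ = K * D * A₁ * (Θ * η ^ p) := by ring
      _ = m * A₁ * (K * D) * η := by rw [e₁]; ring
      _ ≤ _ := mul_le_mul_of_nonneg_right hR₁ hη.le
  · calc _ = K * D * R * (Θ * η ^ p) := by ring
      _ = m * (K * D * R) * η := by rw [e₁]; ring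
      _ ≤ _ := mul_le_mul_of_nonneg_right hR₂ hη.le
  · apply le_of_eq
    calc _ = K * D * R * (Θ * η ^ p) := by ring
      _ = _ := by rw [e₁, hc]; field_simp; ring
  · have e₂ : Θ * (c * (m * η)) ^ p = c ^ (p - 1) * m ^ p * (c * (m * η)) := by
      rw [← e₁]
      have hx : 0 < c * (Θ * η ^ p) := by positivity
      have hmp : m ^ p = Θ * (Θ * η ^ p) ^ (p - 1) := by
        rw [hm, Real.mul_rpow (by positivity) (by positivity),
          Real.mul_rpow (by positivity) (by positivity), ← Real.rpow_mul hη.le,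
          ← Real.rpow_mul hη.le, ← mul_assoc, mul_comm Θ, ← Real.rpow_add_one (by positivity),
          sub_add_cancel, mul_comm p (p - 1)]
      have h := Real.rpow_add_one hx.ne' (p - 1)
      rw [sub_add_cancel] at h
      rw [h, hmp, Real.mul_rpow hc0.le (by positivity)]
      ring
    calc _ = K * (A₁ + A₂) * (Θ * (c * (m * η)) ^ p) := by ring
      _ = (m ^ p * A₁ * L + m ^ p * A₂ * L) * (c * (m * η)) := by rw [e₂, hL]; ring
      _ ≤ (m * A₁ * L + m ^ p * A₂ * L) * (c * (m * η)) := by gcongr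
      _ ≤ (1 / (8 * p) + 1 / (8 * p)) * (c * (m * η)) := by gcongr
      _ = _ := by field_simp; ring

theorem exists_forall_abs_le_of_support {R : ℝ} {φ : ℝ → ℝ} (hφ : Continuous φ)
    (h : ∀ y, R < |y| → φ y = 0) : ∃ C, ∀ y, |φ y| ≤ C := by
  obtain ⟨C, hC⟩ := (isCompact_Icc (a := -R) (b := R)).exists_bound_of_continuousOn hφ.continuousOn
  refine ⟨max C 0, fun y => ?_⟩
  by_cases hy : R < |y|
  · simp [h y hy]
  · exact (hC y (abs_le.1 (not_lt.1 hy))).trans (le_max_left _ _)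

theorem eq_zero_of_tsupport_subset {R : ℝ} {φ : ℝ → ℝ} (h : tsupport φ ⊆ {x : ℝ | |x| ≤ R})
    (y : ℝ) (hy : R < |y|) : φ y = 0 := by
  by_contra hne
  exact hy.not_ge (h (subset_tsupport φ hne))

theorem tsupport_deriv_subset_of_subset {R : ℝ} {φ : ℝ → ℝ} (h : tsupport φ ⊆ {x : ℝ | |x| ≤ R}) :
    tsupport (deriv φ) ⊆ {x : ℝ | |x| ≤ R} :=
  (closure_minimal support_deriv_subset (isClosed_tsupport φ)).trans h

/-- The data of a time interval `I ∋ 0` in `[0,∞)` with a retraction `τ` onto it. -/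
structure IsTimeInterval (I : Set ℝ) (τ : ℝ → ℝ) : Prop where
  uniqueDiffOn : UniqueDiffOn ℝ I
  nonneg : ∀ t ∈ I, 0 ≤ t
  mem_of_le : ∀ t ∈ I, ∀ s, 0 ≤ s → s ≤ t → s ∈ I
  continuous_retract : Continuous τ
  retract_mem : ∀ t, τ t ∈ I
  retract_eq : ∀ t ∈ I, τ t = t

theorem isTimeInterval_Ici : IsTimeInterval (Ici 0) fun t => max 0 t where
  uniqueDiffOn := uniqueDiffOn_Ici 0
  nonneg := fun _ ht => ht
  mem_of_le := fun _ _ _ hs _ => hs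
  continuous_retract := by fun_prop
  retract_mem := fun t => le_max_left 0 t
  retract_eq := fun _ ht => max_eq_right ht

theorem isTimeInterval_Icc {T : ℝ} (hT : 0 < T) :
    IsTimeInterval (Icc 0 T) fun t => max 0 (min t T) where
  uniqueDiffOn := uniqueDiffOn_Icc hT
  nonneg := fun _ ht => ht.1
  mem_of_le := fun _ ht _ hs hst => ⟨hs, hst.trans ht.2⟩
  continuous_retract := by fun_prop
  retract_mem := fun t => ⟨le_max_left 0 _, max_le hT.le (min_le_right t T)⟩
  retract_eq := fun t ht => by rw [min_eq_left ht.2, max_eq_right ht.1]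

/-- A solution exists on `I` as soon as two quantities that measure the decay of the weight on `I`
are small in comparison with the size of the data. -/
theorem exists_threshold {p a b R α K : ℝ} (hp : 1 < p) (hR : 1 ≤ R) {f g : ℝ → ℝ}
    (hf : ContDiff ℝ 2 f) (hg : ContDiff ℝ 1 g)
    (hfR : tsupport f ⊆ {x : ℝ | |x| ≤ R}) (hgR : tsupport g ⊆ {x : ℝ | |x| ≤ R})
    (hα : 0 ≤ α) (hK : 0 < K) :
    ∃ κ : ℝ, 0 < κ ∧ ∀ (ε Θ A₁ A₂ : ℝ) (I : Set ℝ) (τ : ℝ → ℝ), 0 < ε → 1 ≤ Θ → 1 ≤ A₁ →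
      0 ≤ A₂ → IsTimeInterval I τ →
      (∀ y, ∀ s ∈ I, |y| ≤ s + R → (weight a b y s)⁻¹ ≤
        K * Θ * ((1 + s + |y|) ^ (-α) * (1 + |(s - |y|)|) ^ (-(1 + b)))) →
      (∀ t ∈ I, ∫ s in (0 : ℝ)..(2 * t), kern α s ≤ A₁) →
      (∀ t ∈ I, ∫ s in (0 : ℝ)..(2 * t), kern (1 + b + p * α) s ≤ A₂) →
      Θ * ε ^ (p - 1) * A₁ ≤ κ → (Θ * ε ^ (p - 1)) ^ p * A₂ ≤ κ →
      SolutionExists p a b R ε f g I := by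
  have hp0 : 0 < p := by linarith
  have hR0 : 0 ≤ R := by linarith
  have hf' := contDiff_one_deriv hf
  have sf' := tsupport_deriv_subset_of_subset hfR
  have zg := eq_zero_of_tsupport_subset hgR
  have zf' := eq_zero_of_tsupport_subset sf'
  have zg' := eq_zero_of_tsupport_subset (tsupport_deriv_subset_of_subset hgR)
  have zf'' := eq_zero_of_tsupport_subset (tsupport_deriv_subset_of_subset sf')
  obtain ⟨C₁, hC₁⟩ := exists_forall_abs_le_of_support hg.continuous zg
  obtain ⟨C₂, hC₂⟩ := exists_forall_abs_le_of_support hf'.continuous zf'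
  obtain ⟨C₃, hC₃⟩ := exists_forall_abs_le_of_support hg.continuous_deriv_one zg'
  obtain ⟨C₄, hC₄⟩ := exists_forall_abs_le_of_support hf'.continuous_deriv_one zf''
  have n₁ := (abs_nonneg _).trans (hC₁ 0)
  have n₂ := (abs_nonneg _).trans (hC₂ 0)
  have n₃ := (abs_nonneg _).trans (hC₃ 0)
  have n₄ := (abs_nonneg _).trans (hC₄ 0)
  -- `C` also bounds the derivatives of the data, since the same envelope must control `v_x`. The
  -- summand one keeps it positive.
  set C := C₁ + C₂ + C₃ + C₄ + 1 with hC
  have hC0 : 0 < C := by positivity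
  obtain ⟨κ, hκ, H⟩ := exists_envelope_conditions (D := (1 + R) ^ |1 + b|) hp hR
    (Real.one_le_rpow (by linarith) (abs_nonneg _)) hK
  set m := (2 * C) ^ (p - 1) with hm
  have hm0 : 0 < m := by positivity
  refine ⟨min (κ / m) (κ / m ^ p), by positivity,
    fun ε Θ A₁ A₂ I τ hε hΘ hA₁ hA₂ hI hw hi₁ hi₂ h₁ h₂ => ?_⟩
  -- The factor two leaves half of the envelope for the Duhamel term.
  set η := 2 * C * ε with hη
  have hη0 : 0 < η := by positivity
  have e : Θ * η ^ (p - 1) = m * (Θ * ε ^ (p - 1)) := by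
    rw [hη, Real.mul_rpow (by positivity) hε.le]; ring
  have j₁ := h₁.trans (min_le_left _ _)
  have j₂ := h₂.trans (min_le_right _ _)
  rw [le_div_iff₀ (by positivity)] at j₁ j₂
  obtain ⟨B, hB, b₁, b₂, b₃, b₄⟩ := H η Θ A₁ A₂ hη0 hΘ hA₁ hA₂ (by rw [e]; linarith)
    (by rw [e, Real.mul_rpow hm0.le (by positivity)]; linarith)
  -- Applied twice: to the free velocity with `c = 1/2`, and to its `x`-derivative with `c = 1`.
  have src {c : ℝ} {φ ψ : ℝ → ℝ} {E₁ E₂ : ℝ} (hφ : ∀ y, |φ y| ≤ E₁) (hψ : ∀ y, |ψ y| ≤ E₂)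
      (zφ : ∀ y, R < |y| → φ y = 0) (zψ : ∀ y, R < |y| → ψ y = 0) (hc : 0 ≤ c)
      (hE : ε * (E₁ + E₂) ≤ c * η) (x : ℝ) {t : ℝ} (ht : t ∈ I) :
      |ε * ((1 / 2) * (φ (x + t) - φ (x - t) + ψ (x + t) + ψ (x - t)))| ≤
        c * envelope R η B α x t := by
    have h := abs_travel_le (A := fun y => ε * (ψ y + φ y)) (B := fun y => ε * (ψ y - φ y))
      (C := ε * (E₁ + E₂)) (R := R) (x := x) (E := B) (α := α) (η := η) (c := c)
      (fun y => ?_) (fun y => ?_) (fun y hy => by simp [zφ y hy, zψ y hy])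
      (fun y hy => by simp [zφ y hy, zψ y hy]) (hI.nonneg t ht) hR0 hη0.le hB hc hE
    · convert h using 2; ring
    · rw [abs_mul, abs_of_pos hε]
      exact mul_le_mul_of_nonneg_left ((abs_add_le _ _).trans
        (by linarith [hφ y, hψ y])) hε.le
    · rw [abs_mul, abs_of_pos hε]
      exact mul_le_mul_of_nonneg_left ((abs_sub _ _).trans
        (by linarith [hφ y, hψ y])) hε.le
  have HC : IsContractive p a b I τ (fun x t => ε * freeVelocity f g x t)
      (envelope R η B α) (η + B) :=
    { one_lt := hp
      nonneg := hI.nonneg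
      mem_of_le := hI.mem_of_le
      continuous_retract := hI.continuous_retract
      retract_mem := hI.retract_mem
      retract_eq := hI.retract_eq
      continuous_source := continuous_const.mul (continuous_freeVelocity hf hg)
      bound_nonneg := envelope_nonneg hR0 hη0.le hB
      bound_le := fun x t _ => envelope_le hR0 hη0.le hB hα x t
      source_le := fun x t ht => by
        refine (src (c := 1 / 2) hC₂ hC₁ zf' zg (by norm_num) ?_ x ht).trans_eq (by ring)
        rw [hη]
        nlinarith
      duhamel_le := fun h hh hle x t ht => by
        have E := isEnveloped_div_weight hp hR0 hη0.le hB (by positivity) hw hI.nonneg hh hle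
        rw [duhamelVelocity_eq]
        refine (E.abs_half_add_half_le hα (by positivity) hη0.le hB hR0 (δ := 1 / (2 * p))
          (by positivity) (hI.nonneg t ht) (hI.mem_of_le t ht) (hi₁ t ht) (hi₂ t ht)
          b₁ b₂ b₃ b₄).trans_eq ?_
        ring }
  refine HC.solutionExists hf hg hI.uniqueDiffOn (fun x t _ hne => ?_) zero_le_one
    (fun x t ht => src (c := 1) hC₄ hC₃ zf'' zg' zero_le_one ?_ x ht)
  · by_contra hlt
    exact hne (envelope_of_lt (not_le.1 hlt))
  · rw [hη]
    nlinarith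

/-! ### Growth of the kernel integrals and the resulting lifespans -/

theorem kern_anti {γ δ : ℝ} (h : γ ≤ δ) (s : ℝ) : kern δ s ≤ kern γ s :=
  Real.rpow_le_rpow_of_exponent_le (by linarith [abs_nonneg s]) (by linarith)

theorem integral_kern_anti {γ δ X : ℝ} (h : γ ≤ δ) (hX : 0 ≤ X) :
    ∫ s in (0 : ℝ)..X, kern δ s ≤ ∫ s in (0 : ℝ)..X, kern γ s :=
  intervalIntegral.integral_mono_on hX ((continuous_kern δ).intervalIntegrable _ _)
    ((continuous_kern γ).intervalIntegrable _ _) fun s _ => kern_anti h s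

theorem integral_kern_eq {e X : ℝ} (he : e ≠ 0) (hX : 0 ≤ X) :
    ∫ s in (0 : ℝ)..X, kern (1 - e) s = ((1 + X) ^ e - 1) / e := by
  have h := intervalIntegral.integral_eq_sub_of_hasDerivAt (a := 0) (b := X)
    (f := fun s => (1 + s) ^ e / e) (f' := kern (1 - e)) (fun s hs => ?_)
    ((continuous_kern _).intervalIntegrable _ _)
  · rw [h, add_zero, Real.one_rpow, sub_div]
  · rw [uIcc_of_le hX] at hs
    have hs₀ : 0 < 1 + s := by linarith [hs.1]
    refine ((((hasDerivAt_id s).const_add 1).rpow_const (.inl hs₀.ne')).div_const e).congr_deriv ?_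
    rw [kern, abs_of_nonneg hs.1, neg_sub]
    simp only [id]
    field_simp

theorem integral_kern_one {X : ℝ} (hX : 0 ≤ X) :
    ∫ s in (0 : ℝ)..X, kern 1 s = Real.log (1 + X) := by
  have h := intervalIntegral.integral_eq_sub_of_hasDerivAt (a := 0) (b := X)
    (f := fun s => Real.log (1 + s)) (f' := kern 1) (fun s hs => ?_)
    ((continuous_kern _).intervalIntegrable _ _)
  · rw [h, add_zero, Real.log_one, sub_zero]
  · rw [uIcc_of_le hX] at hs
    have hs₀ : 0 < 1 + s := by linarith [hs.1]
    refine (((hasDerivAt_id s).const_add 1).log hs₀.ne').congr_deriv ?_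
    rw [kern, abs_of_nonneg hs.1, Real.rpow_neg_one]
    simp

theorem integral_kern_le_of_one_lt {γ X : ℝ} (hγ : 1 < γ) (hX : 0 ≤ X) :
    ∫ s in (0 : ℝ)..X, kern γ s ≤ 1 / (γ - 1) := by
  have h := integral_kern_eq (e := 1 - γ) (by linarith) hX
  rw [sub_sub_cancel] at h
  rw [h, ← neg_sub γ 1, div_neg, ← neg_div, neg_sub]
  exact div_le_div_of_nonneg_right
    (by linarith [Real.rpow_nonneg (by linarith : (0 : ℝ) ≤ 1 + X) (-(γ - 1))]) (by linarith)

theorem integral_kern_le_log {γ X : ℝ} (hγ : 1 ≤ γ) (hX : 0 ≤ X) :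
    ∫ s in (0 : ℝ)..X, kern γ s ≤ Real.log (1 + X) :=
  (integral_kern_anti hγ hX).trans_eq (integral_kern_one hX)

theorem integral_kern_le_rpow {γ e X : ℝ} (he : 0 < e) (hγ : 1 - e ≤ γ) (hX : 0 ≤ X) :
    ∫ s in (0 : ℝ)..X, kern γ s ≤ (1 + X) ^ e / e :=
  (integral_kern_anti hγ hX).trans ((integral_kern_eq he.ne' hX).trans_le
    (div_le_div_of_nonneg_right (by linarith) he.le))

theorem exists_rpow_le {r μ : ℝ} (hr : 0 < r) (hμ : 0 < μ) :
    ∃ ε₁ : ℝ, 0 < ε₁ ∧ ε₁ ≤ 1 ∧ ∀ ε : ℝ, 0 < ε → ε ≤ ε₁ → ε ^ r ≤ μ := by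
  refine ⟨min 1 (μ ^ r⁻¹), by positivity, min_le_left _ _, fun ε hε hle => ?_⟩
  exact (Real.rpow_le_rpow hε.le (hle.trans (min_le_right _ _)) hr.le).trans_eq
    (Real.rpow_inv_rpow hμ.le hr.ne')

/-- Up to exponentially long times, logarithmic growth is compensated by small data. -/
theorem exists_log_lifespan {r μ : ℝ} (hr : 0 < r) (hμ : 0 < μ) :
    ∃ ε₁ : ℝ, 0 < ε₁ ∧ ∃ c : ℝ, 0 < c ∧ ∀ ε : ℝ, 0 < ε → ε ≤ ε₁ → ∀ T : ℝ, 0 < T →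
      T ≤ Real.exp (c * ε ^ (-r)) → ε ^ r * (1 + Real.log (1 + 2 * T)) ≤ μ := by
  obtain ⟨ε₁, hε₁, -, h⟩ := exists_rpow_le hr (by positivity : 0 < μ / 6)
  -- Half of `μ` pays for the exponential time and half for the constant `3`, which bounds `1 + log
  -- 3` and is absorbed by small `ε`.
  refine ⟨ε₁, hε₁, μ / 2, by positivity, fun ε hε hle T hT hTle => ?_⟩
  set c := μ / 2 with hc
  have hpos : 0 < ε ^ r := Real.rpow_pos_of_pos hε r
  have hm : 0 ≤ c * ε ^ (-r) := by positivity
  have h₁ : 1 + 2 * T ≤ 3 * Real.exp (c * ε ^ (-r)) := by linarith [Real.one_le_exp hm]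
  have h₂ : Real.log (1 + 2 * T) ≤ 2 + c * ε ^ (-r) := by
    refine (Real.log_le_log (by linarith) h₁).trans ?_
    rw [Real.log_mul (by norm_num) (Real.exp_pos _).ne', Real.log_exp]
    linarith [Real.log_le_sub_one_of_pos (by norm_num : (0 : ℝ) < 3)]
  have h₃ : ε ^ r * ε ^ (-r) = 1 := by rw [← Real.rpow_add hε, add_neg_cancel, Real.rpow_zero]
  calc _ ≤ ε ^ r * (3 + c * ε ^ (-r)) := mul_le_mul_of_nonneg_left (by linarith) hpos.le
    _ = 3 * ε ^ r + c * (ε ^ r * ε ^ (-r)) := by ring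
    _ ≤ μ := by rw [h₃]; linarith [h ε hε hle]

/-- Up to times of a power of the inverse size, power growth is compensated by small data. -/
theorem exists_rpow_lifespan {r e μ : ℝ} (hr : 0 < r) (he : 0 < e) (hμ : 0 < μ) :
    ∃ ε₁ : ℝ, 0 < ε₁ ∧ ∃ c : ℝ, 0 < c ∧ ∀ ε : ℝ, 0 < ε → ε ≤ ε₁ → ∀ T : ℝ, 0 < T →
      T ≤ c * ε ^ (-r / e) → ε ^ r * (1 + 2 * T) ^ e ≤ μ := by
  obtain ⟨ε₁, hε₁, -, h⟩ := exists_rpow_le hr (by positivity : 0 < μ / 2 / 2 ^ e)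
  refine ⟨ε₁, hε₁, (μ / 2) ^ e⁻¹ / 4, by positivity, fun ε hε hle T hT hTle => ?_⟩
  have hpos : 0 < ε ^ r := Real.rpow_pos_of_pos hε r
  -- Bounded times are handled by small `ε`, long times by the bound on `T`.
  have h₁ : (1 + 2 * T) ^ e ≤ 2 ^ e + (4 * T) ^ e := by
    have n₁ : (0 : ℝ) ≤ 2 ^ e := by positivity
    have n₂ : 0 ≤ (4 * T) ^ e := by positivity
    rcases le_total (2 * T) 1 with hT' | hT'
    · have := Real.rpow_le_rpow (by linarith) (by linarith : 1 + 2 * T ≤ 2) he.le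
      linarith
    · have := Real.rpow_le_rpow (by linarith) (by linarith : 1 + 2 * T ≤ 4 * T) he.le
      linarith
  have h₂ : (4 * T) ^ e ≤ μ / 2 * ε ^ (-r) := by
    have := Real.rpow_le_rpow (by positivity)
      (by linarith : 4 * T ≤ (μ / 2) ^ e⁻¹ * ε ^ (-r / e)) he.le
    rwa [Real.mul_rpow (x := (μ / 2) ^ e⁻¹) (by positivity) (by positivity),
      Real.rpow_inv_rpow (by positivity) he.ne', ← Real.rpow_mul hε.le,
      div_mul_cancel₀ _ he.ne'] at this
  have h₃ : ε ^ r * ε ^ (-r) = 1 := by rw [← Real.rpow_add hε, add_neg_cancel, Real.rpow_zero]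
  have h₄ := h ε hε hle
  rw [le_div_iff₀ (by positivity)] at h₄
  calc _ ≤ ε ^ r * (2 ^ e + μ / 2 * ε ^ (-r)) := mul_le_mul_of_nonneg_left (by linarith) hpos.le
    _ = ε ^ r * 2 ^ e + μ / 2 * (ε ^ r * ε ^ (-r)) := by ring
    _ ≤ μ := by rw [h₃]; linarith

/-! ### The ranges of `a` and `b` -/

variable {p a b R : ℝ} {f g : ℝ → ℝ}

/-- The superfluous factors `(2 + R)^|1 + a|` and `1` give the bound the shape `K * Θ` shared with
bounded time intervals. -/
theorem inv_weight_le_of_nonneg (a b : ℝ) (hR : 0 ≤ R) (y : ℝ) {s : ℝ}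
    (hs : 0 ≤ s) :
    (weight a b y s)⁻¹ ≤ 3 ^ (|1 + a| + |1 + b|) * (2 + R) ^ |1 + a| * 1 *
      ((1 + s + |y|) ^ (-(1 + a)) * (1 + |(s - |y|)|) ^ (-(1 + b))) := by
  refine (inv_weight_le a b y hs).trans ?_
  have h : 0 ≤ (1 + s + |y|) ^ (-(1 + a)) * (1 + |(s - |y|)|) ^ (-(1 + b)) := by positivity
  refine mul_le_mul_of_nonneg_right ?_ h
  rw [mul_one]
  exact le_mul_of_one_le_right (by positivity) (Real.one_le_rpow (by linarith) (abs_nonneg _))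

/-- If `1 + a < 0`, the power of `1 + s + |y|` grows. In the domain of influence `1 + s + |y| ≤ (2 +
R)(1 + T)`, so this growth moves into a constant depending on `T`, and the remaining exponent is
nonnegative, as the envelope requires. -/
theorem inv_weight_le_of_le (a b : ℝ) (hR : 0 ≤ R) {y s T : ℝ} (hs : 0 ≤ s) (hsT : s ≤ T)
    (hy : |y| ≤ s + R) :
    (weight a b y s)⁻¹ ≤ 3 ^ (|1 + a| + |1 + b|) * (2 + R) ^ |1 + a| *
      (1 + T) ^ max (-(1 + a)) 0 *
      ((1 + s + |y|) ^ (-max (1 + a) 0) * (1 + |(s - |y|)|) ^ (-(1 + b))) := by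
  rcases le_total 0 (1 + a) with ha | ha
  · rw [max_eq_right (by linarith), max_eq_left ha, Real.rpow_zero]
    exact inv_weight_le_of_nonneg a b hR y hs
  · refine (inv_weight_le a b y hs).trans ?_
    rw [max_eq_left (by linarith), max_eq_right ha, neg_zero, Real.rpow_zero, one_mul,
      abs_of_nonpos ha, mul_assoc (3 ^ _), ← Real.mul_rpow (by linarith) (by linarith), mul_assoc]
    refine mul_le_mul_of_nonneg_left (mul_le_mul_of_nonneg_right ?_ (by positivity))
      (by positivity)
    exact Real.rpow_le_rpow (by positivity) (by nlinarith [mul_nonneg (hs.trans hsT) hR])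
      (by linarith)

theorem exists_solution_Ici (hp : 1 < p) (hR : 1 ≤ R) (hf : ContDiff ℝ 2 f) (hg : ContDiff ℝ 1 g)
    (hfR : tsupport f ⊆ {x : ℝ | |x| ≤ R}) (hgR : tsupport g ⊆ {x : ℝ | |x| ≤ R})
    (ha : 0 < a) (hb : 0 < p * (1 + a) + b) :
    ∃ ε₁ : ℝ, 0 < ε₁ ∧ ∀ ε : ℝ, 0 < ε → ε ≤ ε₁ → SolutionExists p a b R ε f g (Ici 0) := by
  obtain ⟨κ, hκ, H⟩ := exists_threshold (a := a) (b := b) (α := 1 + a)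
    (K := 3 ^ (|1 + a| + |1 + b|) * (2 + R) ^ |1 + a|) hp hR hf hg hfR hgR (by linarith)
    (by positivity)
  set q := p * (1 + a) + b with hq
  obtain ⟨ε₁, hε₁, -, h₁⟩ := exists_rpow_le (sub_pos.2 hp)
    (by positivity : 0 < κ / (1 + 1 / a))
  obtain ⟨ε₂, hε₂, -, h₂⟩ := exists_rpow_le (r := (p - 1) * p)
    (mul_pos (sub_pos.2 hp) (by linarith)) (by positivity : 0 < κ * q)
  refine ⟨min ε₁ ε₂, by positivity, fun ε hε hle => ?_⟩
  have i₁ := h₁ ε hε (hle.trans (min_le_left _ _))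
  have i₂ := h₂ ε hε (hle.trans (min_le_right _ _))
  rw [le_div_iff₀ (by positivity)] at i₁
  refine H ε 1 (1 + 1 / a) (1 / q) (Ici 0) _ hε le_rfl
    (by linarith [one_div_pos.2 ha]) (by positivity) isTimeInterval_Ici
    (fun y s hs _ => inv_weight_le_of_nonneg a b (by linarith) y hs)
    (fun t ht => ?_) (fun t ht => ?_) (by rwa [one_mul]) ?_
  · have := integral_kern_le_of_one_lt (γ := 1 + a) (by linarith)
      (mul_nonneg zero_le_two (mem_Ici.1 ht))
    rw [add_sub_cancel_left] at this
    linarith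
  · have := integral_kern_le_of_one_lt (γ := 1 + b + p * (1 + a)) (by linarith)
      (mul_nonneg zero_le_two (mem_Ici.1 ht))
    rwa [show 1 + b + p * (1 + a) - 1 = q by rw [hq]; ring] at this
  · rw [one_mul, ← Real.rpow_mul hε.le, mul_one_div, div_le_iff₀ hb]
    exact i₂

/-- The existence criterion for a bounded time interval. -/
theorem exists_threshold_Icc (a b : ℝ) (hp : 1 < p) (hR : 1 ≤ R) (hf : ContDiff ℝ 2 f)
    (hg : ContDiff ℝ 1 g) (hfR : tsupport f ⊆ {x : ℝ | |x| ≤ R})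
    (hgR : tsupport g ⊆ {x : ℝ | |x| ≤ R}) :
    ∃ κ : ℝ, 0 < κ ∧ ∀ ε T : ℝ, 0 < ε → 0 < T →
      (1 + T) ^ max (-(1 + a)) 0 * ε ^ (p - 1) *
        (1 + ∫ s in (0 : ℝ)..(2 * T), kern (max (1 + a) 0) s) ≤ κ →
      ((1 + T) ^ max (-(1 + a)) 0 * ε ^ (p - 1)) ^ p *
        (∫ s in (0 : ℝ)..(2 * T), kern (1 + b + p * max (1 + a) 0) s) ≤ κ →
      SolutionExists p a b R ε f g (Icc 0 T) := by
  obtain ⟨κ, hκ, H⟩ := exists_threshold (a := a) (b := b) (α := max (1 + a) 0)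
    (K := 3 ^ (|1 + a| + |1 + b|) * (2 + R) ^ |1 + a|) hp hR hf hg hfR hgR (le_max_right _ _)
    (by positivity)
  refine ⟨κ, hκ, fun ε T hε hT h₁ h₂ => ?_⟩
  have hT₂ : 0 ≤ 2 * T := by linarith
  have n₁ := integral_kern_nonneg (max (1 + a) 0) hT₂
  refine H ε _ _ _ (Icc 0 T) _ hε (Real.one_le_rpow (by linarith) (le_max_right _ _))
    (by linarith) (integral_kern_nonneg _ hT₂) (isTimeInterval_Icc hT)
    (fun y s hs hy => inv_weight_le_of_le a b (by linarith) hs.1 hs.2 hy)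
    (fun t ht => ?_) (fun t ht => ?_) h₁ h₂
  · have := integral_kern_mono (max (1 + a) 0) le_rfl (by linarith [ht.1] : 0 ≤ 2 * t)
      (by linarith [ht.2] : 2 * t ≤ 2 * T)
    linarith
  · exact integral_kern_mono _ le_rfl (by linarith [ht.1] : 0 ≤ 2 * t)
      (by linarith [ht.2] : 2 * t ≤ 2 * T)

/-- The lifespan estimate of power type. -/
theorem exists_solution_Icc_rpow {e : ℝ} (hp : 1 < p) (hR : 1 ≤ R) (hf : ContDiff ℝ 2 f)
    (hg : ContDiff ℝ 1 g) (hfR : tsupport f ⊆ {x : ℝ | |x| ≤ R})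
    (hgR : tsupport g ⊆ {x : ℝ | |x| ≤ R}) (he : 0 < e) (ha : -a ≤ e)
    (hb : -(p * (1 + a) + b) ≤ p * e) :
    ∃ ε₁ : ℝ, 0 < ε₁ ∧ ∃ c : ℝ, 0 < c ∧ ∀ ε : ℝ, 0 < ε → ε ≤ ε₁ → ∀ T : ℝ, 0 < T →
      T ≤ c * ε ^ (-(p - 1) / e) → SolutionExists p a b R ε f g (Icc 0 T) := by
  obtain ⟨κ, hκ, H⟩ := exists_threshold_Icc a b hp hR hf hg hfR hgR
  set θ := max (-(1 + a)) 0 with hθ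
  set α := max (1 + a) 0 with hα
  have hp0 : 0 < p := by linarith
  have hθ0 : 0 ≤ θ := le_max_right _ _
  have hαθ : α - θ = 1 + a := by
    rcases le_total 0 (1 + a) with h | h
    · rw [hα, hθ, max_eq_left h, max_eq_right (by linarith), sub_zero]
    · rw [hα, hθ, max_eq_right h, max_eq_left (by linarith)]; ring
  -- `θ` is the part of the growth `T^e` already spent by the prefactor; `d` remains for the kernel
  -- integrals. The two hypotheses on `e` say precisely that these integrals grow no faster than
  -- `T^d` and `T^(p d)`.
  set d := e - θ with hd
  have hd0 : 0 < d := by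
    rw [hd, sub_pos]
    exact max_lt (by linarith) he
  have hpd : 0 < p * d := by positivity
  obtain ⟨ε₁, hε₁, c, hc, h⟩ := exists_rpow_lifespan (sub_pos.2 hp) he
    (μ := min (κ / (1 + 1 / d)) ((κ * (p * d)) ^ p⁻¹)) (by positivity)
  refine ⟨ε₁, hε₁, c, hc, fun ε hε hle T hT hTle => ?_⟩
  have hX : 0 < 1 + 2 * T := by linarith
  have hT₂ : 0 ≤ 2 * T := by linarith
  have hm := h ε hε hle T hT hTle
  have m₁ := hm.trans (min_le_left _ _)
  have m₂ := hm.trans (min_le_right _ _)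
  rw [le_div_iff₀ (by positivity)] at m₁
  have hΘ : (1 + T) ^ θ ≤ (1 + 2 * T) ^ θ :=
    Real.rpow_le_rpow (by linarith) (by linarith) hθ0
  have hsplit : (1 + 2 * T) ^ e = (1 + 2 * T) ^ θ * (1 + 2 * T) ^ d := by
    rw [← Real.rpow_add hX, hd, add_sub_cancel]
  refine H ε T hε hT ?_ ?_
  · have i₁ := integral_kern_le_rpow hd0 (γ := α) (by linarith) hT₂
    have i₂ : 1 ≤ (1 + 2 * T) ^ d := Real.one_le_rpow (by linarith) hd0.le
    have n := integral_kern_nonneg α hT₂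
    calc _ ≤ (1 + 2 * T) ^ θ * ε ^ (p - 1) * ((1 + 2 * T) ^ d + (1 + 2 * T) ^ d / d) := by
          gcongr
      _ = ε ^ (p - 1) * (1 + 2 * T) ^ e * (1 + 1 / d) := by rw [hsplit]; ring
      _ ≤ κ := m₁
  · have hβ : p * α = p * (1 + a) + p * θ := by rw [← hαθ]; ring
    have hpe : p * e = p * d + p * θ := by rw [hd]; ring
    have i₁ := integral_kern_le_rpow hpd (γ := 1 + b + p * α) (by linarith) hT₂
    have n := integral_kern_nonneg (1 + b + p * α) hT₂
    calc _ ≤ ((1 + 2 * T) ^ θ * ε ^ (p - 1)) ^ p * ((1 + 2 * T) ^ (p * d) / (p * d)) := by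
          gcongr
      _ = (ε ^ (p - 1) * (1 + 2 * T) ^ e) ^ p / (p * d) := by
          rw [hsplit, mul_comm p d, Real.rpow_mul hX.le, ← mul_div_assoc,
            ← Real.mul_rpow (by positivity) (by positivity)]
          congr 2; ring
      _ ≤ ((κ * (p * d)) ^ p⁻¹) ^ p / (p * d) := by gcongr
      _ = κ := by
          rw [Real.rpow_inv_rpow (by positivity) hp0.ne', mul_div_cancel_right₀ _ hpd.ne']

/-- The lifespan estimate for `a = 0`. -/
theorem exists_solution_Icc_exp (hp : 1 < p) (hR : 1 ≤ R) (hf : ContDiff ℝ 2 f)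
    (hg : ContDiff ℝ 1 g) (hfR : tsupport f ⊆ {x : ℝ | |x| ≤ R})
    (hgR : tsupport g ⊆ {x : ℝ | |x| ≤ R}) (ha : a = 0) (hb : -p ≤ b) :
    ∃ ε₁ : ℝ, 0 < ε₁ ∧ ∃ c : ℝ, 0 < c ∧ ∀ ε : ℝ, 0 < ε → ε ≤ ε₁ → ∀ T : ℝ, 0 < T →
      T ≤ Real.exp (c * ε ^ (-(p - 1))) → SolutionExists p a b R ε f g (Icc 0 T) := by
  obtain ⟨κ, hκ, H⟩ := exists_threshold_Icc a b hp hR hf hg hfR hgR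
  obtain ⟨ε₁, hε₁, c, hc, h⟩ := exists_log_lifespan (sub_pos.2 hp) hκ
  -- With `ε ≤ 1` the condition on `ε^(p(p-1))` follows from the one on `ε^(p-1)`, both integrals
  -- being at most logarithmic.
  refine ⟨min ε₁ 1, by positivity, c, hc, fun ε hε hle T hT hTle => ?_⟩
  have hT₂ : 0 ≤ 2 * T := by linarith
  have hm := h ε hε (hle.trans (min_le_left _ _)) T hT hTle
  have hpos : 0 < ε ^ (p - 1) := Real.rpow_pos_of_pos hε _
  have hle₁ : ε ^ (p - 1) ≤ 1 :=
    Real.rpow_le_one hε.le (hle.trans (min_le_right _ _)) (by linarith)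
  have e₁ : max (-(1 + a)) 0 = 0 := max_eq_right (by linarith)
  have e₂ : max (1 + a) 0 = 1 := by rw [ha, add_zero, max_eq_left zero_le_one]
  have i₁ := integral_kern_le_log (γ := 1) le_rfl hT₂
  have i₂ := integral_kern_le_log (γ := 1 + b + p * 1) (by linarith) hT₂
  have n := Real.log_nonneg (by linarith : 1 ≤ 1 + 2 * T)
  refine H ε T hε hT ?_ ?_
  · rw [e₁, e₂, Real.rpow_zero, one_mul]
    exact (mul_le_mul_of_nonneg_left (by linarith) hpos.le).trans hm
  · rw [e₁, e₂, Real.rpow_zero, one_mul]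
    refine le_trans ?_ hm
    exact mul_le_mul (by simpa using Real.rpow_le_rpow_of_exponent_ge hpos hle₁ hp.le)
      (by linarith) (integral_kern_nonneg _ hT₂) hpos.le

/-- The lifespan estimate for `p (1 + a) + b = 0`. -/
theorem exists_solution_Icc_exp_of_pos (hp : 1 < p) (hR : 1 ≤ R) (hf : ContDiff ℝ 2 f)
    (hg : ContDiff ℝ 1 g) (hfR : tsupport f ⊆ {x : ℝ | |x| ≤ R})
    (hgR : tsupport g ⊆ {x : ℝ | |x| ≤ R}) (ha : 0 < a) (hb : p * (1 + a) + b = 0) :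
    ∃ ε₁ : ℝ, 0 < ε₁ ∧ ∃ c : ℝ, 0 < c ∧ ∀ ε : ℝ, 0 < ε → ε ≤ ε₁ → ∀ T : ℝ, 0 < T →
      T ≤ Real.exp (c * ε ^ (-(p * (p - 1)))) → SolutionExists p a b R ε f g (Icc 0 T) := by
  obtain ⟨κ, hκ, H⟩ := exists_threshold_Icc a b hp hR hf hg hfR hgR
  have hp1 := sub_pos.2 hp
  obtain ⟨ε₁, hε₁, c, hc, h⟩ := exists_log_lifespan (r := p * (p - 1)) (by positivity) hκ
  obtain ⟨ε₂, hε₂, -, h'⟩ := exists_rpow_le hp1 (by positivity : 0 < κ / (1 + 1 / a))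
  refine ⟨min ε₁ ε₂, by positivity, c, hc, fun ε hε hle T hT hTle => ?_⟩
  have hT₂ : 0 ≤ 2 * T := by linarith
  have hm := h ε hε (hle.trans (min_le_left _ _)) T hT hTle
  have hm' := h' ε hε (hle.trans (min_le_right _ _))
  rw [le_div_iff₀ (by positivity)] at hm'
  have hpos : 0 < ε ^ (p - 1) := Real.rpow_pos_of_pos hε _
  have e₁ : max (-(1 + a)) 0 = 0 := max_eq_right (by linarith)
  have e₂ : max (1 + a) 0 = 1 + a := max_eq_left (by linarith)
  have i₁ := integral_kern_le_of_one_lt (γ := 1 + a) (by linarith) hT₂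
  have i₂ := integral_kern_le_log (γ := 1 + b + p * (1 + a)) (by linarith) hT₂
  rw [add_sub_cancel_left] at i₁
  refine H ε T hε hT ?_ ?_
  · rw [e₁, e₂, Real.rpow_zero, one_mul]
    exact (mul_le_mul_of_nonneg_left (by linarith) hpos.le).trans hm'
  · rw [e₁, e₂, Real.rpow_zero, one_mul, ← Real.rpow_mul hε.le, mul_comm (p - 1)]
    exact (mul_le_mul_of_nonneg_left (by linarith) (by positivity)).trans hm

/-- Constants for a statement that holds only under a condition on the parameters. -/
theorem exists_consts_of_imp {P : Prop} {Q : ℝ → ℝ → Prop}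
    (h : P → ∃ ε₁ : ℝ, 0 < ε₁ ∧ ∃ c : ℝ, 0 < c ∧ ∀ ε : ℝ, 0 < ε → ε ≤ ε₁ → Q c ε) :
    ∃ ε₁ : ℝ, 0 < ε₁ ∧ ∃ c : ℝ, 0 < c ∧ ∀ ε : ℝ, 0 < ε → ε ≤ ε₁ → P → Q c ε := by
  by_cases hP : P
  · obtain ⟨ε₁, h₁, c, hc, h⟩ := h hP
    exact ⟨ε₁, h₁, c, hc, fun ε hε hle _ => h ε hε hle⟩
  · exact ⟨1, one_pos, 1, one_pos, fun _ _ _ hP' => absurd hP' hP⟩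

end WeightedWave

end

/-! ### Assembly of the cases -/

theorem mainTheorem1 (p a b R : ℝ) (hp : 1 < p) (hR : 1 ≤ R) (f g : ℝ → ℝ)
    (hf : ContDiff ℝ 2 f) (hg : ContDiff ℝ 1 g)
    (hfR : tsupport f ⊆ {x : ℝ | |x| ≤ R}) (hgR : tsupport g ⊆ {x : ℝ | |x| ≤ R}) :
    ∃ ε₁ : ℝ, 0 < ε₁ ∧ ∃ c : ℝ, 0 < c ∧ ∀ ε : ℝ, 0 < ε → ε ≤ ε₁ →
      (0 < a → 0 < p * (1 + a) + b →
        WeightedWave.SolutionExists p a b R ε f g (Set.Ici 0)) ∧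
      ∀ T : ℝ, 0 < T →
        ((a = 0 → -p ≤ b → T ≤ Real.exp (c * ε ^ (-(p - 1))) →
          WeightedWave.SolutionExists p a b R ε f g (Set.Icc 0 T)) ∧
        (0 < a → p * (1 + a) + b = 0 → T ≤ Real.exp (c * ε ^ (-(p * (p - 1)))) →
          WeightedWave.SolutionExists p a b R ε f g (Set.Icc 0 T)) ∧
        (a < 0 → -p ≤ b → T ≤ c * ε ^ (-(p - 1) / (-a)) →
          WeightedWave.SolutionExists p a b R ε f g (Set.Icc 0 T)) ∧
        (p * (1 + a) + b < 0 → b < -p →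
          T ≤ c * ε ^ (-(p * (p - 1)) / (-(p * (1 + a)) - b)) →
          WeightedWave.SolutionExists p a b R ε f g (Set.Icc 0 T))) := by
  have hp0 : 0 < p := by linarith
  obtain ⟨ε₀, hε₀, -, -, H₀⟩ := WeightedWave.exists_consts_of_imp
    (P := 0 < a ∧ 0 < p * (1 + a) + b)
    (Q := fun _ ε => WeightedWave.SolutionExists p a b R ε f g (Set.Ici 0)) (fun h => by
      obtain ⟨ε₁, h₁, H⟩ := WeightedWave.exists_solution_Ici hp hR hf hg hfR hgR h.1 h.2
      exact ⟨ε₁, h₁, 1, one_pos, H⟩)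
  obtain ⟨ε₁, hε₁, c₁, hc₁, H₁⟩ := WeightedWave.exists_consts_of_imp (fun h : a = 0 ∧ -p ≤ b =>
    WeightedWave.exists_solution_Icc_exp hp hR hf hg hfR hgR h.1 h.2)
  obtain ⟨ε₂, hε₂, c₂, hc₂, H₂⟩ := WeightedWave.exists_consts_of_imp
    (fun h : 0 < a ∧ p * (1 + a) + b = 0 =>
      WeightedWave.exists_solution_Icc_exp_of_pos hp hR hf hg hfR hgR h.1 h.2)
  obtain ⟨ε₃, hε₃, c₃, hc₃, H₃⟩ := WeightedWave.exists_consts_of_imp (fun h : a < 0 ∧ -p ≤ b =>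
    WeightedWave.exists_solution_Icc_rpow (b := b) hp hR hf hg hfR hgR (neg_pos.2 h.1) le_rfl
      (by linarith [h.2]))
  obtain ⟨ε₄, hε₄, c₄, hc₄, H₄⟩ := WeightedWave.exists_consts_of_imp
    (fun h : p * (1 + a) + b < 0 ∧ b < -p =>
      -- The growth rate is the larger of `-a` and `-(p(1+a)+b)/p`. The comparison of the two is
      -- that of `b` with `-p`; here the second one dominates, and in the preceding case `-a` does.
      WeightedWave.exists_solution_Icc_rpow (a := a) (b := b) (e := (-(p * (1 + a)) - b) / p)
        hp hR hf hg hfR hgR (div_pos (by linarith [h.1]) hp0)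
        (by rw [le_div_iff₀ hp0]; linarith [h.2])
        (by rw [mul_div_cancel₀ _ hp0.ne']; linarith))
  refine ⟨min ε₀ (min (min ε₁ ε₂) (min ε₃ ε₄)), by positivity, min (min c₁ c₂) (min c₃ c₄),
    by positivity, fun ε hε hle => ?_⟩
  obtain ⟨l₀, l⟩ := le_min_iff.1 hle
  obtain ⟨l₁₂, l₃₄⟩ := le_min_iff.1 l
  obtain ⟨l₁, l₂⟩ := le_min_iff.1 l₁₂
  obtain ⟨l₃, l₄⟩ := le_min_iff.1 l₃₄
  set c := min (min c₁ c₂) (min c₃ c₄) with hc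
  have k₁ : c ≤ c₁ := (min_le_left _ _).trans (min_le_left _ _)
  have k₂ : c ≤ c₂ := (min_le_left _ _).trans (min_le_right _ _)
  have k₃ : c ≤ c₃ := (min_le_right _ _).trans (min_le_left _ _)
  have k₄ : c ≤ c₄ := (min_le_right _ _).trans (min_le_right _ _)
  have mono {c' : ℝ} (h : c ≤ c') (r : ℝ) : c * ε ^ r ≤ c' * ε ^ r :=
    mul_le_mul_of_nonneg_right h (Real.rpow_nonneg hε.le r)
  refine ⟨fun ha hb => H₀ ε hε l₀ ⟨ha, hb⟩, fun T hT => ⟨fun ha hb hTle => ?_, fun ha hb hTle => ?_,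
    fun ha hb hTle => ?_, fun ha hb hTle => ?_⟩⟩
  · exact H₁ ε hε l₁ ⟨ha, hb⟩ T hT (hTle.trans (Real.exp_le_exp.2 (mono k₁ _)))
  · exact H₂ ε hε l₂ ⟨ha, hb⟩ T hT (hTle.trans (Real.exp_le_exp.2 (mono k₂ _)))
  · exact H₃ ε hε l₃ ⟨ha, hb⟩ T hT (hTle.trans (mono k₃ _))
  · refine H₄ ε hε l₄ ⟨ha, hb⟩ T hT ((hTle.trans (mono k₄ _)).trans_eq ?_)
    rw [div_div_eq_mul_div, neg_mul, mul_comm (p - 1)]
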